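/- All vector spaces are over a field $K$ of characteristic $0$; in an exponent of $-1$ a homogeneous element stands for its degree. A \emph{symmetric graded Lie algebra} is a $\mathbb Z$-graded vector space $\mathfrak h=\bigoplus_i\mathfrak h^i$ with a bilinear bracket of degree $1$ such that, for homogeneous $x,y,z$, $[x,y]=(-1)^{xy}[y,x]$ and $[x,[y,z]]=(-1)^{x+1}[[x,y],z]+(-1)^{(x+1)(y+1)}[y,[x,z]]$. Let $\mathrm{Der}^n(\mathfrak h)$ be the space of degree $n$ linear maps $D$ with $D[x,y]=(-1)^n[Dx,y]+(-1)^{n(x+1)}[x,Dy]$, let $\mathrm{Der}(\mathfrak h)=\bigoplus_n\mathrm{Der}^n(\mathfrak h)$ with the graded commutator $[D,E]=DE-(-1)^{DE}ED$, and let $(s^{-1}\mathrm{Der}(\mathfrak h))^i=\mathrm{Der}^{i+1}(\mathfrak h)$; here $s$ and $s^{-1}$ are the identity on underlying vectors. Let $S(\mathfrak h)=\bigoplus_{k\ge0}S^k(\mathfrak h)$ be the graded symmetric algebra, with Koszul sign given by $v_1\odot\cdots\odot v_k=\varepsilon(\sigma)\,v_{\sigma(1)}\odot\cdots\odot v_{\sigma(k)}$,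 and let $\bar{\mathcal C}^n=\mathrm{Hom}^n(S(\mathfrak h),s^{-1}\mathrm{Der}(\mathfrak h))$ be the space of linear maps of degree $n$. For $\alpha\in\bar{\mathcal C}^n$ write $\alpha_k(v_1,\dots,v_k)=\alpha(v_1\odot\cdots\odot v_k)$. The suspension $s\bar{\mathcal C}^*$ has $\bar{\mathcal C}^{n}$ in degree $n+1$. $\mathbb S_{(i_1,\dots,i_r)}$ denotes the set of $(i_1,\dots,i_r)$-shuffles (empty if some $i_t<0$). For $\alpha\in\bar{\mathcal C}^m$, $\beta\in\bar{\mathcal C}^n$ and homogeneous $v_1,\dots,v_p\in\mathfrak h$, $p\ge 0$, put $$(\partial\beta)_p(v_1,\dots,v_p)=\sum_{1\le i<j\le p}(-1)^{n+1+v_i(v_1+\cdots+v_{i-1})+v_j(v_1+\cdots+v_{j-1})+v_iv_j}\,\beta_{p-1}([v_i,v_j],v_1,\dots,\hat v_i,\dots,\hat v_j,\dots,v_p),$$ $$\begin{aligned}[\alpha,\beta]^c_p(v_1,\dots,v_p)={}&-\sum_{k+l=p+1}\ \sum_{\sigma\in\mathbb S_{(l,1,p-l-1)}}\varepsilon(\sigma)\,\alpha_{k-1}\big(s(\beta_l(v_{\sigma(1)},\dots,v_{\sigma(l)}))v_{\sigma(l+1)},v_{\sigma(l+2)},\dots,v_{\sigma(p)}\big)\\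 &+(-1)^{(m+1)(n+1)}\sum_{k+l=p+1}\ \sum_{\sigma\in\mathbb S_{(k-1,1,p-k)}}\varepsilon(\sigma)\,\beta_l\big(s(\alpha_{k-1}(v_{\sigma(1)},\dots,v_{\sigma(k-1)}))v_{\sigma(k)},v_{\sigma(k+1)},\dots,v_{\sigma(p)}\big)\\ &-\sum_{k+l=p+1}\ \sum_{\sigma\in\mathbb S_{(k-1,l)}}(-1)^{(n+1)(v_{\sigma(1)}+\cdots+v_{\sigma(k-1)})}\varepsilon(\sigma)\,s^{-1}\big[s\alpha_{k-1}(v_{\sigma(1)},\dots,v_{\sigma(k-1)}),s\beta_l(v_{\sigma(k)},\dots,v_{\sigma(p)})\big]\end{aligned}$$ (with $k\ge1$, $l\ge0$). An \emph{operator homotopy post-Lie algebra structure} on $\mathfrak h$ is a family of linear maps $\theta_k:\mathfrak h^{\otimes k}\to\mathfrak h$ ($k\ge1$) of degree $1$ such that for all $n\ge1$ and homogeneous $x_1,\dots,x_{n+1}$: (i) $\theta_n(x_{\sigma(1)},\dots,x_{\sigma(n-1)},x_n)=\varepsilon(\sigma)\theta_n(x_1,\dots,x_n)$ for $\sigma\in\mathbb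 S_{n-1}$; (ii) $\theta_n(x_1,\dots,x_{n-1},[x_n,x_{n+1}])=(-1)^{x_1+\cdots+x_{n-1}+1}[\theta_n(x_1,\dots,x_n),x_{n+1}]+(-1)^{(x_1+\cdots+x_{n-1}+1)(x_n+1)}[x_n,\theta_n(x_1,\dots,x_{n-1},x_{n+1})]$; (iii) $$\begin{aligned}&\sum_{\substack{i+j=n+1\\ i\ge1,\,j\ge2}}\ \sum_{\sigma\in\mathbb S_{(i-1,1,j-2)}}\varepsilon(\sigma)\,\theta_j(\theta_i(x_{\sigma(1)},\dots,x_{\sigma(i)}),x_{\sigma(i+1)},\dots,x_{\sigma(n-1)},x_n)\\ &+\sum_{\substack{i+j=n+1\\ i\ge1,\,j\ge1}}\ \sum_{\sigma\in\mathbb S_{(j-1,i-1)}}(-1)^{x_{\sigma(1)}+\cdots+x_{\sigma(j-1)}}\varepsilon(\sigma)\,\theta_j(x_{\sigma(1)},\dots,x_{\sigma(j-1)},\theta_i(x_{\sigma(j)},\dots,x_{\sigma(n-1)},x_n))\\ &=\sum_{1\le i<j\le n-1}(-1)^{x_i(x_1+\cdots+x_{i-1})+x_j(x_1+\cdots+x_{j-1})+x_ix_j+1}\,\theta_{n-1}([x_i,x_j],x_1,\dots,\hat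 x_i,\dots,\hat x_j,\dots,x_n).\end{aligned}$$ \textbf{Theorem.} Let $\mathfrak h$ be a symmetric graded Lie algebra. The formulas above determine unique bilinear maps $[\cdot,\cdot]^c:\bar{\mathcal C}^m\times\bar{\mathcal C}^n\to\bar{\mathcal C}^{m+n+1}$ and linear maps $\partial:\bar{\mathcal C}^n\to\bar{\mathcal C}^{n+1}$, and $(s\bar{\mathcal C}^*,[\cdot,\cdot]^c,\partial)$ is a differential graded Lie algebra. An element $L=\sum_{k\ge0}L_k\in\bar{\mathcal C}^0=(s\bar{\mathcal C}^*)^1$ is a Maurer--Cartan element, i.e. $\partial L+\frac12[L,L]^c=0$, if and only if the maps $$\theta_k(v_1,\dots,v_k)=\big(sL_{k-1}(v_1,\dots,v_{k-1})\big)v_k\qquad(k\ge1)$$ form an operator homotopy post-Lie algebra structure on $\mathfrak h$; and every such structure arises in this way from exactly one $L\in\bar{\mathcal C}^0$. -/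

import Mathlib

open scoped DirectSum TensorProduct

namespace OpPostLie

/-! ### Signs and shuffles -/

/-- The Koszul sign `ε(σ; v₁, …, vₙ)` for homogeneous `vᵢ` of degree `d i`, that is the sign with
`v₁ ⊙ ⋯ ⊙ vₙ = ε(σ; v₁, …, vₙ) v_{σ(1)} ⊙ ⋯ ⊙ v_{σ(n)}`: one factor `(-1)^{|x||y|}` for each pair
of entries that change their order. -/
def koszulSign {n : ℕ} (d : Fin n → ℤ) (σ : Equiv.Perm (Fin n)) : ℤˣ :=
  ∏ q ∈ (Finset.univ : Finset (Fin n × Fin n)).filter (fun q => q.1 < q.2 ∧ σ q.2 < σ q.1),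
    (d (σ q.1) * d (σ q.2)).negOnePow

/-- The `(c₁, …, c_k)`-shuffles in the symmetric group on `n = c₁ + ⋯ + c_k` letters: the
permutations that are increasing on each of the `k` consecutive blocks of lengths `c₁, …, c_k`. -/
def shuffles (n : ℕ) (c : List ℕ) : Finset (Equiv.Perm (Fin n)) :=
  (Finset.univ : Finset (Equiv.Perm (Fin n))).filter (fun σ =>
    ∀ a < c.length, ∀ i j : Fin n,
      (c.take a).sum ≤ (i : ℕ) → i < j → (j : ℕ) < (c.take (a + 1)).sum → σ i < σ j)

/-- The total degree `|v_{σ(1)}| + ⋯ + |v_{σ(a)}|` of the first `a` permuted entries. -/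
def headDeg {n : ℕ} (d : Fin n → ℤ) (σ : Equiv.Perm (Fin n)) (a : ℕ) : ℤ :=
  ∑ i ∈ (Finset.univ : Finset (Fin n)).filter (fun i : Fin n => (i : ℕ) < a), d (σ i)

/-- The total degree `|v_{σ(a+1)}| + ⋯ + |v_{σ(n)}|` of the remaining permuted entries. -/
def tailDeg {n : ℕ} (d : Fin n → ℤ) (σ : Equiv.Perm (Fin n)) (a : ℕ) : ℤ :=
  ∑ i ∈ (Finset.univ : Finset (Fin n)).filter (fun i : Fin n => a ≤ (i : ℕ)), d (σ i)

/-! ### Differential graded Lie algebras -/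

/-- A differential graded Lie algebra structure, over a field of characteristic zero, on the
`ℤ`-graded vector space `⨁ i, L i`. Identities between elements whose degrees are equal but not
syntactically equal are written in the direct sum. -/
structure DGLieAlgebra (K : Type*) [Field K] (L : ℤ → Type*)
    [∀ i, AddCommGroup (L i)] [∀ i, Module K (L i)] where
  /-- the graded Lie bracket, of degree `0` -/
  bracket : ∀ i j : ℤ, L i →ₗ[K] L j →ₗ[K] L (i + j)
  /-- the differential, of degree `1` -/
  diff : ∀ i : ℤ, L i →ₗ[K] L (i + 1)
  skew : ∀ (i j : ℤ) (x : L i) (y : L j),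
    DirectSum.lof K ℤ L (i + j) (bracket i j x y) =
      -((i * j).negOnePow • DirectSum.lof K ℤ L (j + i) (bracket j i y x))
  jacobi : ∀ (i j k : ℤ) (x : L i) (y : L j) (z : L k),
    DirectSum.lof K ℤ L (i + (j + k)) (bracket i (j + k) x (bracket j k y z)) =
      DirectSum.lof K ℤ L (i + j + k) (bracket (i + j) k (bracket i j x y) z) +
      (i * j).negOnePow •
        DirectSum.lof K ℤ L (j + (i + k)) (bracket j (i + k) y (bracket i k x z))
  diff_diff : ∀ (i : ℤ) (x : L i), diff (i + 1) (diff i x) = 0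
  diff_bracket : ∀ (i j : ℤ) (x : L i) (y : L j),
    DirectSum.lof K ℤ L (i + j + 1) (diff (i + j) (bracket i j x y)) =
      DirectSum.lof K ℤ L (i + 1 + j) (bracket (i + 1) j (diff i x) y) +
      i.negOnePow • DirectSum.lof K ℤ L (i + (j + 1)) (bracket i (j + 1) x (diff j y))

/-- Maurer-Cartan elements: degree `1` elements with `d θ + (1/2) [θ, θ] = 0`. -/
def DGLieAlgebra.IsMaurerCartan {K : Type*} [Field K] {L : ℤ → Type*}
    [∀ i, AddCommGroup (L i)] [∀ i, Module K (L i)] (D : DGLieAlgebra K L) (θ : L 1) : Prop :=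
  D.diff 1 θ + (1 / 2 : K) • D.bracket 1 1 θ θ = 0

section Graded

variable {K V : Type*} [Field K] [AddCommGroup V] [Module K V]

/-! ### Symmetric graded Lie algebras and their derivations -/

/-- A symmetric graded Lie algebra structure on the graded vector space `V = ⨁ i, 𝒱 i`: a bilinear
bracket of degree `1`, graded symmetric, with the graded Leibniz rule. -/
structure IsSymGradedLie (𝒱 : ℤ → Submodule K V) (br : V →ₗ[K] V →ₗ[K] V) : Prop where
  degree : ∀ (i j : ℤ) (x y : V), x ∈ 𝒱 i → y ∈ 𝒱 j → br x y ∈ 𝒱 (i + j + 1)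
  symm : ∀ (i j : ℤ) (x y : V), x ∈ 𝒱 i → y ∈ 𝒱 j → br x y = (i * j).negOnePow • br y x
  leibniz : ∀ (i j k : ℤ) (x y z : V), x ∈ 𝒱 i → y ∈ 𝒱 j → z ∈ 𝒱 k →
    br x (br y z) = (i + 1).negOnePow • br (br x y) z +
      ((i + 1) * (j + 1)).negOnePow • br y (br x z)

/-- `Derⁿ`: the derivations of degree `n` of `(V, br)`, i.e. linear maps of degree `n` with
`D[x, y] = (-1)ⁿ [D x, y] + (-1)^{n(x+1)} [x, D y]`. -/
def derDeg (𝒱 : ℤ → Submodule K V) (br : V →ₗ[K] V →ₗ[K] V) (n : ℤ) :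
    Submodule K (Module.End K V) where
  carrier := {D | (∀ (i : ℤ) (x : V), x ∈ 𝒱 i → D x ∈ 𝒱 (i + n)) ∧
    ∀ (i j : ℤ) (x y : V), x ∈ 𝒱 i → y ∈ 𝒱 j →
      D (br x y) = n.negOnePow • br (D x) y + (n * (i + 1)).negOnePow • br x (D y)}
  zero_mem' := by
    refine ⟨fun i x _ => ?_, fun i j x y _ _ => ?_⟩ <;> simp
  add_mem' := by
    rintro D E ⟨hD, hD'⟩ ⟨hE, hE'⟩
    refine ⟨fun i x hx => ?_, fun i j x y hx hy => ?_⟩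
    · exact Submodule.add_mem _ (hD i x hx) (hE i x hx)
    · simp only [LinearMap.add_apply, map_add, smul_add, hD' i j x y hx hy, hE' i j x y hx hy]
      abel
  smul_mem' := by
    rintro c D ⟨hD, hD'⟩
    refine ⟨fun i x hx => ?_, fun i j x y hx hy => ?_⟩
    · exact Submodule.smul_mem _ c (hD i x hx)
    · simp only [LinearMap.smul_apply, map_smul, hD' i j x y hx hy, smul_add, smul_comm c]

/-- The graded commutator of endomorphisms `A` of degree `a` and `B` of degree `b`. -/
def gradedComm (a b : ℤ) (A B : Module.End K V) : Module.End K V :=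
  A * B - (a * b).negOnePow • (B * A)

/-! ### The symmetric algebra of a graded vector space -/

/-- The relations `v₁ ⊗ ⋯ ⊗ v_k = ε(σ; v₁, …, v_k) v_{σ(1)} ⊗ ⋯ ⊗ v_{σ(k)}`. -/
def symRel (𝒱 : ℤ → Submodule K V) (k : ℕ) : Submodule K (⨂[K] _ : Fin k, V) :=
  Submodule.span K {t | ∃ (d : Fin k → ℤ) (v : Fin k → V) (σ : Equiv.Perm (Fin k)),
    (∀ i, v i ∈ 𝒱 (d i)) ∧
      t = PiTensorProduct.tprod K v -
        koszulSign d σ • PiTensorProduct.tprod K (fun i => v (σ i))}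

/-- The symmetric power `S^k(V)`, the graded symmetric coinvariants of `V^{⊗ k}`. -/
abbrev SymPow (𝒱 : ℤ → Submodule K V) (k : ℕ) : Type _ :=
  (⨂[K] _ : Fin k, V) ⧸ symRel 𝒱 k

/-- The vector space `S(V) = ⨁ k, S^k(V)` underlying the symmetric algebra. -/
abbrev SymAlg (𝒱 : ℤ → Submodule K V) : Type _ := ⨁ k : ℕ, SymPow 𝒱 k

/-- The multilinear map `(v₁, …, v_k) ↦ v₁ ⊙ ⋯ ⊙ v_k ∈ S^k(V) ⊆ S(V)`. Hence the value
`f_k(v₁, …, v_k)` of the component `f_k` of a linear map `f` on `S(V)` is `f (symProd 𝒱 k v)`. -/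
noncomputable def symProd (𝒱 : ℤ → Submodule K V) (k : ℕ) :
    MultilinearMap K (fun _ : Fin k => V) (SymAlg 𝒱) :=
  ((DirectSum.lof K ℕ (fun k => SymPow 𝒱 k) k).comp
    (symRel 𝒱 k).mkQ).compMultilinearMap (PiTensorProduct.tprod K)

/-- `v₁ ⊙ ⋯ ⊙ v_k` for a list `[v₁, …, v_k]`. -/
noncomputable def symList (𝒱 : ℤ → Submodule K V) (l : List V) : SymAlg 𝒱 :=
  symProd 𝒱 l.length l.get

/-- The component of degree `n` of `S(V)`, where `v₁ ⊙ ⋯ ⊙ v_k` has degree `|v₁| + ⋯ + |v_k|`. -/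
def symDeg (𝒱 : ℤ → Submodule K V) (n : ℤ) : Submodule K (SymAlg 𝒱) :=
  Submodule.span K {t | ∃ (k : ℕ) (d : Fin k → ℤ) (v : Fin k → V),
    (∀ i, v i ∈ 𝒱 (d i)) ∧ ∑ i, d i = n ∧ t = symProd 𝒱 k v}

/-- Linear maps of degree `n` with respect to given gradings. -/
def homDeg {A B : Type*} [AddCommMonoid A] [Module K A] [AddCommMonoid B] [Module K B]
    (𝒜 : ℤ → Submodule K A) (ℬ : ℤ → Submodule K B) (n : ℤ) : Submodule K (A →ₗ[K] B) where
  carrier := {f | ∀ (i : ℤ) (x : A), x ∈ 𝒜 i → f x ∈ ℬ (i + n)}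
  zero_mem' := fun i x _ => by simp
  add_mem' := fun hf hg i x hx => Submodule.add_mem _ (hf i x hx) (hg i x hx)
  smul_mem' := fun c _ hf i x hx => Submodule.smul_mem _ c (hf i x hx)

/-! ### The differential graded Lie algebra of cochains -/

/-- `Homⁿ(S(V), s⁻¹Der(V))`, where `(s⁻¹Der(V))ⁱ = Derⁱ⁺¹(V)`; the desuspension `s⁻¹` is the
identity on underlying vectors. As the homogeneous components span `S(V)`, such maps automatically
have their values in the sum of the subspaces `Derⁱ(V)` of `End(V)`. -/
def cochain (𝒱 : ℤ → Submodule K V) (br : V →ₗ[K] V →ₗ[K] V) (n : ℤ) :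
    Submodule K (SymAlg 𝒱 →ₗ[K] Module.End K V) :=
  homDeg (symDeg 𝒱) (fun i => derDeg 𝒱 br (i + 1)) n

/-- The component of degree `i` of the suspension `s Hom(S(V), s⁻¹Der(V))`. -/
abbrev sCochain (𝒱 : ℤ → Submodule K V) (br : V →ₗ[K] V →ₗ[K] V) (i : ℤ) : Type _ :=
  cochain 𝒱 br (i - 1)

/-- `γ = ∂ β` for `β` of degree `n` in `Hom(S(V), s⁻¹Der(V))`: for all `p` and all homogeneous
`v₁, …, v_p`, `γ_p(v₁, …, v_p) = ∑_{i<j} ± β_{p-1}([vᵢ, vⱼ], v₁, …, v̂ᵢ, …, v̂ⱼ, …, v_p)`. -/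
def IsCochainDiff (𝒱 : ℤ → Submodule K V) (br : V →ₗ[K] V →ₗ[K] V) (n : ℤ)
    (β γ : SymAlg 𝒱 →ₗ[K] Module.End K V) : Prop :=
  ∀ (p : ℕ) (d : Fin p → ℤ) (v : Fin p → V), (∀ i, v i ∈ 𝒱 (d i)) →
    γ (symProd 𝒱 p v) =
      ∑ i : Fin p, ∑ j ∈ Finset.Ioi i,
        (n + 1 + d i * (∑ a ∈ Finset.Iio i, d a) + d j * (∑ a ∈ Finset.Iio j, d a)
          + d i * d j).negOnePow •
        β (symList 𝒱 (br (v i) (v j) :: ((List.ofFn v).eraseIdx j).eraseIdx i))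

/-- The sum, over `k + l = p + 1` and over the `(l, 1, p - l - 1)`-shuffles `σ`, of
`ε(σ) α_{k-1}(s(β_l(v_{σ(1)}, …, v_{σ(l)})) v_{σ(l+1)}, v_{σ(l+2)}, …, v_{σ(p)})`. -/
noncomputable def insertion (𝒱 : ℤ → Submodule K V) (α β : SymAlg 𝒱 →ₗ[K] Module.End K V)
    {p : ℕ} (d : Fin p → ℤ) (v : Fin p → V) : Module.End K V :=
  ∑ l : Fin p, ∑ σ ∈ shuffles p [(l : ℕ), 1, p - l - 1],
    koszulSign d σ •
      α (symList 𝒱 (β (symList 𝒱 ((List.ofFn (fun i => v (σ i))).take l)) (v (σ l)) ::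
        (List.ofFn (fun i => v (σ i))).drop (l + 1)))

/-- `γ = [α, β]^c` for `α` of degree `m` and `β` of degree `n` in `Hom(S(V), s⁻¹Der(V))`. -/
def IsCochainBracket (𝒱 : ℤ → Submodule K V) (m n : ℤ)
    (α β γ : SymAlg 𝒱 →ₗ[K] Module.End K V) : Prop :=
  ∀ (p : ℕ) (d : Fin p → ℤ) (v : Fin p → V), (∀ i, v i ∈ 𝒱 (d i)) →
    γ (symProd 𝒱 p v) =
      -insertion 𝒱 α β d v
      + ((m + 1) * (n + 1)).negOnePow • insertion 𝒱 β α d v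
      - ∑ a ∈ Finset.range (p + 1), ∑ σ ∈ shuffles p [a, p - a],
          ((n + 1) * headDeg d σ a).negOnePow • koszulSign d σ •
            gradedComm
              (m + 1 + headDeg d σ a)
              (n + 1 + tailDeg d σ a)
              (α (symList 𝒱 ((List.ofFn (fun i => v (σ i))).take a)))
              (β (symList 𝒱 ((List.ofFn (fun i => v (σ i))).drop a)))

/-! ### Operator homotopy post-Lie algebras -/

/-- `θ_{k+1}(v₁, …, v_k, x)` for a list `[v₁, …, v_k]` and a last argument `x`; the map `θ_{k+1}`
with `k + 1` arguments is stored as `θ k`. -/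
def opEval (θ : ∀ k : ℕ, MultilinearMap K (fun _ : Fin (k + 1) => V) V) (l : List V) (x : V) : V :=
  θ l.length (Fin.snoc (α := fun _ => V) l.get x)

/-- An operator homotopy post-Lie algebra structure on the symmetric graded Lie algebra
`(V, br)`: linear maps `θ_k : V^{⊗ k} → V` of degree `1`, `k ≥ 1`, with `θ_{k+1}` stored as `θ k`,
that are graded symmetric in all arguments but the last, graded derivations in the last argument,
and satisfy the higher homotopy relations. -/
structure IsOpHomotopyPostLie (𝒱 : ℤ → Submodule K V) (br : V →ₗ[K] V →ₗ[K] V)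
    (θ : ∀ k : ℕ, MultilinearMap K (fun _ : Fin (k + 1) => V) V) : Prop where
  degree : ∀ (k : ℕ) (d : Fin (k + 1) → ℤ) (v : Fin (k + 1) → V), (∀ i, v i ∈ 𝒱 (d i)) →
    θ k v ∈ 𝒱 (∑ i, d i + 1)
  symm : ∀ (p : ℕ) (d : Fin p → ℤ) (v : Fin p → V) (e : ℤ) (x : V),
    (∀ i, v i ∈ 𝒱 (d i)) → x ∈ 𝒱 e → ∀ σ : Equiv.Perm (Fin p),
      θ p (Fin.snoc (α := fun _ => V) (fun i => v (σ i)) x) =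
        koszulSign d σ • θ p (Fin.snoc (α := fun _ => V) v x)
  derivation : ∀ (p : ℕ) (d : Fin p → ℤ) (v : Fin p → V) (e e' : ℤ) (x y : V),
    (∀ i, v i ∈ 𝒱 (d i)) → x ∈ 𝒱 e → y ∈ 𝒱 e' →
      θ p (Fin.snoc (α := fun _ => V) v (br x y)) =
        (∑ i, d i + 1).negOnePow • br (θ p (Fin.snoc (α := fun _ => V) v x)) y
        + ((∑ i, d i + 1) * (e + 1)).negOnePow • br x (θ p (Fin.snoc (α := fun _ => V) v y))
  relation : ∀ (p : ℕ) (d : Fin p → ℤ) (v : Fin p → V) (e : ℤ) (x : V),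
    (∀ i, v i ∈ 𝒱 (d i)) → x ∈ 𝒱 e →
      (∑ a : Fin p, ∑ σ ∈ shuffles p [(a : ℕ), 1, p - a - 1],
        koszulSign d σ •
          opEval θ (opEval θ ((List.ofFn (fun i => v (σ i))).take a) (v (σ a)) ::
            (List.ofFn (fun i => v (σ i))).drop (a + 1)) x)
      + (∑ a ∈ Finset.range (p + 1), ∑ σ ∈ shuffles p [a, p - a],
        (headDeg d σ a).negOnePow • koszulSign d σ •
          opEval θ ((List.ofFn (fun i => v (σ i))).take a)
            (opEval θ ((List.ofFn (fun i => v (σ i))).drop a) x))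
      = ∑ i : Fin p, ∑ j ∈ Finset.Ioi i,
        (d i * (∑ a ∈ Finset.Iio i, d a) + d j * (∑ a ∈ Finset.Iio j, d a)
          + d i * d j + 1).negOnePow •
        opEval θ (br (v i) (v j) :: ((List.ofFn v).eraseIdx j).eraseIdx i) x

/-- The operations `θ_{k+1}(v₁, …, v_{k+1}) = (s L_k(v₁, …, v_k)) v_{k+1}` of a cochain `L`. -/
noncomputable def opOfCochain (𝒱 : ℤ → Submodule K V) (L : SymAlg 𝒱 →ₗ[K] Module.End K V) (k : ℕ) :
    MultilinearMap K (fun _ : Fin (k + 1) => V) V :=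
  MultilinearMap.uncurryRight (M := fun _ : Fin (k + 1) => V)
    (L.compMultilinearMap (symProd 𝒱 k))

end Graded

end OpPostLie

open OpPostLie

namespace OpPostLie

/-! ### The Koszul sign -/

/-! Linear maps out of `SymAlg 𝒱` behave like formal power series on V: `contract` is a partial
derivative and evaluation at `word 𝒱 []` is the value at the origin. A map into V is a formal vector
field X, acting by `lieDer` (written L_X). A cochain α defines the vector field vf(α): x ↦ α(x)x
(`vfMap`), and the bracket of V defines Q(x) = ½[x,x] (`quadMap`).

Put α ◁ β = L_{vf β} α + αβ (`preLie`). Then vf(α ◁ β) = L_{vf β} vf(α) (`vfMap_preLie`). Vector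
fields obey the graded pre-Lie identity (`lieDer_lieDer`) and act by derivations on products
(`lieDer_prodMap`), so ◁ is a graded right pre-Lie product (`preLie_symm`). The bracket [·,·]^c is
minus its graded commutator, hence a Lie bracket (`lieBr_jacobi`). It stays derivation-valued
because plain products enter it only through αβ ∓ βα.

The differential is L_Q up to a sign. The Jacobi identity says L_Q Q = 0, which gives ∂² = 0. For
derivation-valued β, β(x)[x,x] = ±2[β(x)x, x], so the commutator of Q with vf(β) is vf(L_Q β), and
L_Q is a derivation of ◁ (`lieDer_quadMap_preLie`).

For L of degree 1, ½[L,L]^c = −L ◁ L, so the Maurer–Cartan equation reads L ◁ L = ∂L. Evaluated on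
v₁ ⊙ ⋯ ⊙ v_p and applied to one more vector, this is relation (iii). Relations (i), (ii) and the
degree condition say exactly that the θ_k come from a derivation-valued map on the symmetric
algebra.

Identities between products and derivatives are proved by induction on words: contracting with a
letter turns an identity into a signed sum of instances of itself, so only the empty word carries
content. The shuffle sums are matched by deciding where the first letter goes (`splitSum`,
`markedSum`, `pairSum`). -/

theorem prod_lt_comp_perm {n : ℕ} {M : Type*} [CommMonoid M] (g : Fin n → Fin n → M)
    (hg : ∀ i j, g i j = g j i) (τ : Equiv.Perm (Fin n)) :
    ∏ q ∈ (Finset.univ : Finset (Fin n × Fin n)).filter (fun q => q.1 < q.2), g (τ q.1) (τ q.2) =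
      ∏ q ∈ (Finset.univ : Finset (Fin n × Fin n)).filter (fun q => q.1 < q.2), g q.1 q.2 := by
  let f : Equiv.Perm (Fin n) → Fin n × Fin n → Fin n × Fin n :=
    fun ρ q => if ρ q.1 < ρ q.2 then (ρ q.1, ρ q.2) else (ρ q.2, ρ q.1)
  have key : ∀ (ρ : Equiv.Perm (Fin n)) (q : Fin n × Fin n), q.1 < q.2 →
      (f ρ q).1 < (f ρ q).2 ∧ f ρ.symm (f ρ q) = q := by
    rintro ρ ⟨a, b⟩ hab
    have hne : ρ a ≠ ρ b := fun h => hab.ne (ρ.injective h)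
    dsimp only at hab
    by_cases h : ρ a < ρ b
    · simp [f, h, hab]
    · simp [f, h, hab.not_gt, lt_of_le_of_ne (not_lt.1 h) hne.symm]
  refine Finset.prod_bij' (fun q _ => f τ q) (fun q _ => f τ.symm q) ?_ ?_ ?_ ?_ ?_
  · intro q hq
    simpa using (key τ q (by simpa using hq)).1
  · intro q hq
    simpa using (key τ.symm q (by simpa using hq)).1
  · intro q hq
    exact (key τ q (by simpa using hq)).2
  · intro q hq
    exact (key τ.symm q (by simpa using hq)).2
  · intro q _
    by_cases h : τ q.1 < τ q.2
    · simp [f, h]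
    · simp only [f, h, if_false]
      exact hg _ _

/-- A pair inverted by both factors contributes its sign twice and drops out. This cocycle rule
reduces signs of permutations to adjacent transpositions. -/
theorem koszulSign_mul {n : ℕ} (d : Fin n → ℤ) (σ τ : Equiv.Perm (Fin n)) :
    koszulSign d (σ * τ) = koszulSign d σ * koszulSign (fun i => d (σ i)) τ := by
  -- `G` depends only on the unordered pair, so the product for σ can be reindexed along τ.
  let G : Fin n → Fin n → ℤˣ := fun x y =>
    if (x < y ∧ σ y < σ x) ∨ (y < x ∧ σ x < σ y) then (d (σ x) * d (σ y)).negOnePow else 1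
  have h1 : koszulSign d σ =
      ∏ q ∈ (Finset.univ : Finset (Fin n × Fin n)).filter (fun q => q.1 < q.2), G q.1 q.2 := by
    rw [koszulSign, ← Finset.filter_filter, Finset.prod_filter]
    refine Finset.prod_congr rfl fun q hq => ?_
    have hq' : q.1 < q.2 := by simpa using hq
    simp [G, hq', hq'.not_gt]
  have h2 := prod_lt_comp_perm G (fun i j => by
    simp only [G, mul_comm (d (σ i)), or_comm]) τ
  rw [h1, ← h2, koszulSign, koszulSign, ← Finset.filter_filter, 
    ← Finset.filter_filter, Finset.prod_filter,
    Finset.prod_filter (p := fun q : Fin n × Fin n => τ q.2 < τ q.1), ← Finset.prod_mul_distrib]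
  refine Finset.prod_congr rfl fun q hq => ?_
  have hq' : q.1 < q.2 := by simpa using hq
  have hne : τ q.1 ≠ τ q.2 := fun h => hq'.ne (τ.injective h)
  have hne' : σ (τ q.1) ≠ σ (τ q.2) := fun h => hne (σ.injective h)
  simp only [G, Equiv.Perm.mul_apply]
  rcases lt_or_gt_of_ne hne with h | h <;> rcases lt_or_gt_of_ne hne' with h' | h' <;>
    simp [h, h', h.not_gt, h'.not_gt]

theorem koszulSign_one {n : ℕ} (d : Fin n → ℤ) : koszulSign d 1 = 1 := by
  refine Finset.prod_eq_one fun q hq => ?_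
  have hq' := (Finset.mem_filter.1 hq).2
  exact absurd hq'.1 hq'.2.not_gt

theorem koszulSign_swap {n : ℕ} (d : Fin (n + 1) → ℤ) (i : Fin n) :
    koszulSign d (Equiv.swap i.castSucc i.succ) = (d i.castSucc * d i.succ).negOnePow := by
  rw [koszulSign, Finset.prod_eq_single (i.castSucc, i.succ)]
  · simp [mul_comm]
  · rintro ⟨a, b⟩ h hne
    exfalso
    simp only [Finset.mem_filter, Finset.mem_univ, true_and] at h
    obtain ⟨h1, h2⟩ := h
    simp only [Equiv.swap_apply_def] at h2
    apply hne
    simp only [Fin.ext_iff, Fin.lt_def, Prod.mk.injEq, Fin.val_castSucc, Fin.val_succ] at *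
    split_ifs at h2 <;> simp_all <;> omega
  · intro h
    exact absurd (by simp) h

/-! ### Words in homogeneous letters and the universal property of the symmetric algebra -/

section Words

variable {K V : Type*} [Field K] [AddCommGroup V] [Module K V] (𝒱 : ℤ → Submodule K V)

theorem symList_ofFn {k : ℕ} (v : Fin k → V) : symList 𝒱 (List.ofFn v) = symProd 𝒱 k v := by
  have : ∀ (p q : Σ k : ℕ, Fin k → V), p = q → symProd 𝒱 p.1 p.2 = symProd 𝒱 q.1 q.2 := by
    rintro p q rfl; rfl
  exact this ⟨_, (List.ofFn v).get⟩ ⟨k, v⟩ (List.equivSigmaTuple.apply_symm_apply ⟨k, v⟩)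

theorem ofFn_update {α : Type*} {k : ℕ} (w : Fin k → α) (i : Fin k) (x : α) :
    List.ofFn (Function.update w i x) = (List.ofFn w).set i x := by
  refine List.ext_getElem (by simp) fun n h1 h2 => ?_
  rw [List.getElem_set]
  simp only [List.getElem_ofFn, Function.update_apply, Fin.ext_iff, eq_comm]

theorem append_cons_eq_ofFn_update {α : Type*} (l₁ l₂ : List α) (z x : α) :
    l₁ ++ x :: l₂ = List.ofFn (Function.update (l₁ ++ z :: l₂).get ⟨l₁.length, by simp⟩ x) := by
  rw [ofFn_update, List.ofFn_get]
  simp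

theorem symList_append_cons_add (l₁ l₂ : List V) (x y : V) :
    symList 𝒱 (l₁ ++ (x + y) :: l₂) = symList 𝒱 (l₁ ++ x :: l₂) + symList 𝒱 (l₁ ++ y :: l₂) := by
  rw [append_cons_eq_ofFn_update l₁ l₂ 0 (x + y), append_cons_eq_ofFn_update l₁ l₂ 0 x,
    append_cons_eq_ofFn_update l₁ l₂ 0 y, symList_ofFn, symList_ofFn, symList_ofFn,
    MultilinearMap.map_update_add]

theorem symList_append_cons_smul (l₁ l₂ : List V) (c : K) (x : V) :
    symList 𝒱 (l₁ ++ (c • x) :: l₂) = c • symList 𝒱 (l₁ ++ x :: l₂) := by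
  rw [append_cons_eq_ofFn_update l₁ l₂ 0 (c • x), append_cons_eq_ofFn_update l₁ l₂ 0 x,
    symList_ofFn, symList_ofFn, MultilinearMap.map_update_smul]

theorem symProd_perm {k : ℕ} (d : Fin k → ℤ) (v : Fin k → V) (hv : ∀ i, v i ∈ 𝒱 (d i))
    (σ : Equiv.Perm (Fin k)) :
    symProd 𝒱 k v = koszulSign d σ • symProd 𝒱 k (fun i => v (σ i)) := by
  have h : PiTensorProduct.tprod K v -
      koszulSign d σ • PiTensorProduct.tprod K (fun i => v (σ i)) ∈ symRel 𝒱 k :=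
    Submodule.subset_span ⟨d, v, σ, hv, rfl⟩
  rw [← Submodule.Quotient.mk_eq_zero, Submodule.Quotient.mk_sub, sub_eq_zero] at h
  simp only [symProd, LinearMap.compMultilinearMap_apply, LinearMap.comp_apply,
    Submodule.mkQ_apply, h, Units.smul_def]
  exact map_zsmul ((DirectSum.lof K ℕ (fun k => SymPow 𝒱 k) k).comp (symRel 𝒱 k).mkQ) _ _

/-- The element of the symmetric algebra given by a word in homogeneous letters. -/
noncomputable def word (l : List (Σ i, 𝒱 i)) : SymAlg 𝒱 := symList 𝒱 (l.map fun h => (h.2 : V))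

theorem word_ofFn {k : ℕ} (x : Fin k → Σ i, 𝒱 i) :
    word 𝒱 (List.ofFn x) = symProd 𝒱 k (fun i => ((x i).2 : V)) := by
  rw [word, List.map_ofFn, symList_ofFn]; rfl

theorem ofFn_comp_swap {α : Type*} {n : ℕ} (x : Fin (n + 1) → α) (i : Fin n) :
    ∃ l₁ l₂ : List α, l₁.length = (i : ℕ) ∧
      List.ofFn x = l₁ ++ x i.castSucc :: x i.succ :: l₂ ∧
      List.ofFn (fun j => x (Equiv.swap i.castSucc i.succ j)) =
        l₁ ++ x i.succ :: x i.castSucc :: l₂ := by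
  have hl : ((List.ofFn x).take i).length = (i : ℕ) := by
    rw [List.length_take, List.length_ofFn]; omega
  have e : List.ofFn x = (List.ofFn x).take i ++ x i.castSucc :: x i.succ ::
      (List.ofFn x).drop (i + 1 + 1) := by
    conv_lhs => rw [← List.take_append_drop i (List.ofFn x)]
    rw [List.drop_eq_getElem_cons (by rw [List.length_ofFn]; omega),
      List.drop_eq_getElem_cons (by rw [List.length_ofFn]; omega),
      List.getElem_ofFn, List.getElem_ofFn]
    rfl
  have hx : (fun j => x (Equiv.swap i.castSucc i.succ j)) =
      Function.update (Function.update x i.castSucc (x i.succ)) i.succ (x i.castSucc) := by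
    funext j
    simp only [Equiv.swap_apply_def, Function.update_apply]
    split_ifs with h1 h2 <;> simp_all
  refine ⟨_, _, hl, e, ?_⟩
  generalize (List.ofFn x).take i = l₁ at *
  generalize (List.ofFn x).drop (i + 1 + 1) = l₂ at *
  rw [hx, ofFn_update, ofFn_update, e, Fin.val_castSucc, Fin.val_succ, ← hl]
  simp

theorem word_swap (l₁ l₂ : List (Σ i, 𝒱 i)) (g h : Σ i, 𝒱 i) :
    word 𝒱 (l₁ ++ g :: h :: l₂) = (g.1 * h.1).negOnePow • word 𝒱 (l₁ ++ h :: g :: l₂) := by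
  obtain ⟨n, x, hn, hx⟩ : ∃ (n : ℕ) (x : Fin (n + 1) → Σ i, 𝒱 i), l₁.length < n ∧
      List.ofFn x = l₁ ++ g :: h :: l₂ := by
    have hlen : (l₁ ++ g :: h :: l₂).length = l₁.length + l₂.length + 1 + 1 := by
      simp; omega
    exact ⟨l₁.length + l₂.length + 1, (l₁ ++ g :: h :: l₂).get ∘ Fin.cast hlen.symm, by omega,
      List.ext_getElem (by rw [List.length_ofFn, hlen]) fun m h1 h2 => by
        rw [List.getElem_ofFn]; rfl⟩
  obtain ⟨l₁', l₂', hl, e1, e2⟩ := ofFn_comp_swap x ⟨l₁.length, hn⟩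
  obtain ⟨rfl, e⟩ := List.append_inj (hx.symm.trans e1) hl.symm
  simp only [List.cons.injEq] at e
  obtain ⟨hg, hh, rfl⟩ := e
  rw [← hg, ← hh] at e2
  rw [← hx, ← e2, word_ofFn, word_ofFn,
    symProd_perm 𝒱 (fun j => (x j).1) _ (fun j => (x j).2.2) (Equiv.swap _ _),
    koszulSign_swap, ← hg, ← hh]

/-- A function of words in homogeneous letters is graded symmetric multilinear if it is linear in
each letter and changes by the Koszul sign when two neighbouring letters are exchanged. -/
structure IsSymMultilinear {W : Type*} [AddCommGroup W] [Module K W]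
    (Φ : List (Σ i, 𝒱 i) → W) : Prop where
  add : ∀ (l₁ l₂ : List (Σ i, 𝒱 i)) (i : ℤ) (x y : 𝒱 i),
    Φ (l₁ ++ ⟨i, x + y⟩ :: l₂) = Φ (l₁ ++ ⟨i, x⟩ :: l₂) + Φ (l₁ ++ ⟨i, y⟩ :: l₂)
  smul : ∀ (l₁ l₂ : List (Σ i, 𝒱 i)) (i : ℤ) (c : K) (x : 𝒱 i),
    Φ (l₁ ++ ⟨i, c • x⟩ :: l₂) = c • Φ (l₁ ++ ⟨i, x⟩ :: l₂)
  swap : ∀ (l₁ l₂ : List (Σ i, 𝒱 i)) (g h : Σ i, 𝒱 i),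
    Φ (l₁ ++ g :: h :: l₂) = (g.1 * h.1).negOnePow • Φ (l₁ ++ h :: g :: l₂)

variable {𝒱}

/-- Adjacent transpositions generate the symmetric group, and `koszulSign_mul` follows the sign
along a product of them. -/
theorem IsSymMultilinear.perm {W : Type*} [AddCommGroup W] [Module K W]
    {Φ : List (Σ i, 𝒱 i) → W} (hΦ : IsSymMultilinear 𝒱 Φ) {k : ℕ} (σ : Equiv.Perm (Fin k))
    (x : Fin k → Σ i, 𝒱 i) :
    Φ (List.ofFn x) = koszulSign (fun i => (x i).1) σ • Φ (List.ofFn fun i => x (σ i)) := by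
  cases k with
  | zero =>
    rw [Subsingleton.elim σ 1, koszulSign_one, one_smul]; rfl
  | succ n =>
    have hσ : σ ∈ Submonoid.closure (Set.range fun i : Fin n => Equiv.swap i.castSucc i.succ) := by
      rw [Equiv.Perm.mclosure_swap_castSucc_succ]; trivial
    induction hσ using Submonoid.closure_induction generalizing x with
    | mem σ h =>
      obtain ⟨i, rfl⟩ := h
      dsimp only
      obtain ⟨l₁, l₂, -, e, e2⟩ := ofFn_comp_swap x i
      rw [koszulSign_swap, e, e2, hΦ.swap]
    | one => rw [koszulSign_one, one_smul]; rfl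
    | mul σ τ _ _ h1 h2 =>
      rw [koszulSign_mul, h1, h2 (fun i => x (σ i)), smul_smul]; rfl

/-- Because V is the direct sum of its components, a multilinear map may be prescribed separately on
each tuple of degrees, with no compatibility between tuples. -/
theorem IsSymMultilinear.exists_multilinearMap [DirectSum.Decomposition 𝒱] {W : Type*}
    [AddCommGroup W] [Module K W] {Φ : List (Σ i, 𝒱 i) → W} (hΦ : IsSymMultilinear 𝒱 Φ) (k : ℕ) :
    ∃ F : MultilinearMap K (fun _ : Fin k => V) W,
      ∀ x : Fin k → Σ i, 𝒱 i, F (fun i => ((x i).2 : V)) = Φ (List.ofFn x) := by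
  have hset : ∀ (p : Fin k → ℤ) (v : ∀ i, 𝒱 (p i)) (i : Fin k), ∃ l₁ l₂ : List (Σ i, 𝒱 i),
      ∀ y : 𝒱 (p i), List.ofFn (fun j => (⟨p j, Function.update v i y j⟩ : Σ i, 𝒱 i)) =
        l₁ ++ ⟨p i, y⟩ :: l₂ := by
    intro p v i
    refine ⟨(List.ofFn fun j => (⟨p j, v j⟩ : Σ i, 𝒱 i)).take i,
      (List.ofFn fun j => (⟨p j, v j⟩ : Σ i, 𝒱 i)).drop (i + 1), fun y => ?_⟩
    have : (fun j => (⟨p j, Function.update v i y j⟩ : Σ i, 𝒱 i)) =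
        Function.update (fun j => (⟨p j, v j⟩ : Σ i, 𝒱 i)) i ⟨p i, y⟩ := by
      funext j
      by_cases h : j = i
      · subst h; simp
      · simp [h]
    rw [this, ofFn_update, List.set_eq_take_append_cons_drop, if_pos (by simp)]
  let F : (p : Fin k → ℤ) → MultilinearMap K (fun i => 𝒱 (p i)) W := fun p =>
    { toFun := fun v => Φ (List.ofFn fun j => ⟨p j, v j⟩)
      map_update_add' := by
        intro inst v i x y
        rw [Subsingleton.elim inst (instDecidableEqFin k)]
        obtain ⟨l₁, l₂, h⟩ := hset p v i
        rw [h, h, h, hΦ.add]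
      map_update_smul' := by
        intro inst v i c x
        rw [Subsingleton.elim inst (instDecidableEqFin k)]
        obtain ⟨l₁, l₂, h⟩ := hset p v i
        rw [h, h, hΦ.smul] }
  refine ⟨(MultilinearMap.fromDirectSumEquiv
    (M := fun (_ : Fin k) (j : ℤ) => 𝒱 j) F).compLinearMap
      (fun _ => (DirectSum.decomposeLinearEquiv 𝒱).toLinearMap), fun x => ?_⟩
  rw [MultilinearMap.compLinearMap_apply]
  simp only [LinearEquiv.coe_coe, DirectSum.decomposeLinearEquiv_apply_coe]
  exact MultilinearMap.fromDirectSumEquiv_lof (R := K)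
    (M := fun (_ : Fin k) (j : ℤ) => 𝒱 j) F (fun i => (x i).1) (fun i => (x i).2)

theorem multilinearMap_ext_homogeneous [DirectSum.Decomposition 𝒱] {W : Type*}
    [AddCommGroup W] [Module K W] {k : ℕ} {F G : MultilinearMap K (fun _ : Fin k => V) W}
    (h : ∀ x : Fin k → Σ i, 𝒱 i, F (fun i => ((x i).2 : V)) = G (fun i => ((x i).2 : V))) :
    F = G := by
  have : F.compLinearMap (fun _ => (DirectSum.decomposeLinearEquiv 𝒱).symm.toLinearMap) =
      G.compLinearMap (fun _ => (DirectSum.decomposeLinearEquiv 𝒱).symm.toLinearMap) := by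
    refine MultilinearMap.directSum_ext fun p => MultilinearMap.ext fun v => ?_
    simpa using h fun i => ⟨p i, v i⟩
  ext v
  simpa using congrArg (fun H => H fun i => DirectSum.decomposeLinearEquiv 𝒱 (v i)) this

/-- Words in homogeneous letters span, which turns equalities of maps into inductions on lists. -/
theorem symAlg_ext [DirectSum.Decomposition 𝒱] {W : Type*} [AddCommGroup W] [Module K W]
    {f g : SymAlg 𝒱 →ₗ[K] W} (h : ∀ l, f (word 𝒱 l) = g (word 𝒱 l)) : f = g := by
  refine DirectSum.linearMap_ext K fun k => Submodule.linearMap_qext _ (PiTensorProduct.ext ?_)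
  refine multilinearMap_ext_homogeneous (𝒱 := 𝒱) fun x => ?_
  have := h (List.ofFn x)
  rwa [word_ofFn] at this

/-- The universal property of the symmetric algebra. -/
theorem IsSymMultilinear.exists_linearMap [DirectSum.Decomposition 𝒱] {W : Type*}
    [AddCommGroup W] [Module K W] {Φ : List (Σ i, 𝒱 i) → W} (hΦ : IsSymMultilinear 𝒱 Φ) :
    ∃ F : SymAlg 𝒱 →ₗ[K] W, ∀ l, F (word 𝒱 l) = Φ l := by
  choose F hF using hΦ.exists_multilinearMap
  have hle : ∀ k, symRel 𝒱 k ≤ LinearMap.ker (PiTensorProduct.lift (F k)) := by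
    intro k
    rw [symRel, Submodule.span_le]
    rintro _ ⟨d, v, σ, hv, rfl⟩
    have h1 := hF k fun i => ⟨d i, v i, hv i⟩
    have h2 := hF k fun i => ⟨d (σ i), v (σ i), hv (σ i)⟩
    have h3 := hΦ.perm σ fun i => ⟨d i, v i, hv i⟩
    simp only at h1 h2 h3
    rw [SetLike.mem_coe, LinearMap.mem_ker, map_sub, Units.smul_def, map_zsmul,
      PiTensorProduct.lift.tprod, PiTensorProduct.lift.tprod, h1, h2, h3, Units.smul_def, sub_self]
  refine ⟨DirectSum.toModule K ℕ W fun k => (symRel 𝒱 k).liftQ _ (hle k), fun l => ?_⟩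
  rw [← List.ofFn_get l, word_ofFn, symProd, LinearMap.compMultilinearMap_apply,
    LinearMap.comp_apply, DirectSum.toModule_lof, Submodule.mkQ_apply, Submodule.liftQ_apply,
    PiTensorProduct.lift.tprod, hF]

theorem word_append_cons_add (l₁ l₂ : List (Σ i, 𝒱 i)) (i : ℤ) (x y : 𝒱 i) :
    word 𝒱 (l₁ ++ ⟨i, x + y⟩ :: l₂) =
      word 𝒱 (l₁ ++ ⟨i, x⟩ :: l₂) + word 𝒱 (l₁ ++ ⟨i, y⟩ :: l₂) := by
  simp only [word, List.map_append, List.map_cons, Submodule.coe_add, symList_append_cons_add]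

theorem word_append_cons_smul (l₁ l₂ : List (Σ i, 𝒱 i)) (i : ℤ) (c : K) (x : 𝒱 i) :
    word 𝒱 (l₁ ++ ⟨i, c • x⟩ :: l₂) = c • word 𝒱 (l₁ ++ ⟨i, x⟩ :: l₂) := by
  simp only [word, List.map_append, List.map_cons, Submodule.coe_smul, symList_append_cons_smul]

variable [DirectSum.Decomposition 𝒱]

theorem exists_mulLeft (h : Σ i, 𝒱 i) :
    ∃ F : SymAlg 𝒱 →ₗ[K] SymAlg 𝒱, ∀ l, F (word 𝒱 l) = word 𝒱 (h :: l) :=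
  IsSymMultilinear.exists_linearMap (Φ := fun l => word 𝒱 (h :: l))
    ⟨fun l₁ => word_append_cons_add (h :: l₁), fun l₁ => word_append_cons_smul (h :: l₁),
      fun l₁ => word_swap 𝒱 (h :: l₁)⟩

/-- Multiplication from the left by a homogeneous element in the symmetric algebra. -/
noncomputable def mulLeft (h : Σ i, 𝒱 i) : SymAlg 𝒱 →ₗ[K] SymAlg 𝒱 := (exists_mulLeft h).choose

theorem mulLeft_word (h : Σ i, 𝒱 i) (l : List (Σ i, 𝒱 i)) :
    mulLeft h (word 𝒱 l) = word 𝒱 (h :: l) := (exists_mulLeft h).choose_spec l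

/-- The contraction `f ↦ f (h ⊙ -)`. -/
noncomputable def contract (W : Type*) [AddCommGroup W] [Module K W] (h : Σ i, 𝒱 i) :
    (SymAlg 𝒱 →ₗ[K] W) →ₗ[K] SymAlg 𝒱 →ₗ[K] W := LinearMap.lcomp K W (mulLeft h)

section
variable {W : Type*} [AddCommGroup W] [Module K W]

theorem contract_word (h : Σ i, 𝒱 i) (f : SymAlg 𝒱 →ₗ[K] W) (l : List (Σ i, 𝒱 i)) :
    contract W h f (word 𝒱 l) = f (word 𝒱 (h :: l)) := by
  rw [contract, LinearMap.lcomp_apply, mulLeft_word]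

theorem contract_add (i : ℤ) (x y : 𝒱 i) :
    contract W ⟨i, x + y⟩ = contract W ⟨i, x⟩ + contract W ⟨i, y⟩ := by
  refine LinearMap.ext fun f => symAlg_ext fun l => ?_
  simp only [LinearMap.add_apply, contract_word, ← map_add]
  exact congrArg f (word_append_cons_add [] l i x y)

theorem contract_smul (i : ℤ) (c : K) (x : 𝒱 i) :
    contract W ⟨i, c • x⟩ = c • contract W ⟨i, x⟩ := by
  refine LinearMap.ext fun f => symAlg_ext fun l => ?_
  simp only [LinearMap.smul_apply, contract_word, ← map_smul]
  exact congrArg f (word_append_cons_smul [] l i c x)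

/-- Graded symmetry of second partial derivatives, the source of the symmetry in `lieDer_lieDer`. -/
theorem contract_contract (g h : Σ i, 𝒱 i) (f : SymAlg 𝒱 →ₗ[K] W) :
    contract W h (contract W g f) = (g.1 * h.1).negOnePow • contract W g (contract W h f) := by
  refine symAlg_ext fun l => ?_
  rw [LinearMap.smul_apply, contract_word, contract_word, contract_word, contract_word]
  refine (congrArg f (word_swap 𝒱 [] l g h)).trans ?_
  rcases Int.units_eq_one_or (g.1 * h.1).negOnePow with e | e <;> simp [e]

end

end Words

/-! ### Signs -/

section Sign

variable (K : Type*) [Field K]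

/-- The sign `(-1)ⁿ` as a scalar. -/
def sgn (n : ℤ) : K := ((n.negOnePow : ℤ) : K)

variable {K}

theorem negOnePow_smul {W : Type*} [AddCommGroup W] [Module K W] (n : ℤ) (x : W) :
    n.negOnePow • x = sgn K n • x := by
  rw [sgn, Units.smul_def, Int.cast_smul_eq_zsmul]

theorem sgn_zero : sgn K 0 = 1 := by simp [sgn]

theorem sgn_one : sgn K 1 = -1 := by simp [sgn]

theorem sgn_add (a b : ℤ) : sgn K (a + b) = sgn K a * sgn K b := by
  simp [sgn, Int.negOnePow_add]

theorem sgn_of_even {a : ℤ} (h : Even a) : sgn K a = 1 := by simp [sgn, Int.negOnePow_even a h]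

theorem sgn_of_odd {a : ℤ} (h : Odd a) : sgn K a = -1 := by simp [sgn, Int.negOnePow_odd a h]

/-- Every sign identity below is settled by splitting the degrees into even and odd. Each
alternative also rewrites the sign of a product, which leaves a linear goal for `module`. -/
theorem sgn_parity (a : ℤ) :
    (sgn K a = 1 ∧ ∀ b, sgn K (a * b) = 1 ∧ sgn K (b * a) = 1) ∨
      (sgn K a = -1 ∧ ∀ b, sgn K (a * b) = sgn K b ∧ sgn K (b * a) = sgn K b) := by
  rcases Int.even_or_odd a with h | h
  · exact Or.inl ⟨sgn_of_even h, fun b => ⟨sgn_of_even (h.mul_right b), sgn_of_even (h.mul_left b)⟩⟩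
  · refine Or.inr ⟨sgn_of_odd h, fun b => ?_⟩
    rcases Int.even_or_odd b with h' | h'
    · exact ⟨by rw [sgn_of_even h', sgn_of_even (h'.mul_left a)],
        by rw [sgn_of_even h', sgn_of_even (h'.mul_right a)]⟩
    · exact ⟨by rw [sgn_of_odd h', sgn_of_odd (h.mul h')],
        by rw [sgn_of_odd h', sgn_of_odd (h'.mul h)]⟩

theorem sgn_mul_self (a : ℤ) : sgn K a * sgn K a = 1 := by
  rcases sgn_parity (K := K) a with h | h <;> simp [h.1]

end Sign

/-! ### Operations on linear maps out of the symmetric algebra -/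

section WordDeg

variable {K V : Type*} [Field K] [AddCommGroup V] [Module K V] {𝒱 : ℤ → Submodule K V}

/-- The total degree of a word. -/
def wordDeg (l : List (Σ i, 𝒱 i)) : ℤ := (l.map Sigma.fst).sum

theorem wordDeg_nil : wordDeg ([] : List (Σ i, 𝒱 i)) = 0 := rfl

theorem wordDeg_cons (h : Σ i, 𝒱 i) (l : List (Σ i, 𝒱 i)) :
    wordDeg (h :: l) = h.1 + wordDeg l := by simp [wordDeg]

end WordDeg

section Convolution

variable {K V : Type*} [Field K] [AddCommGroup V] [Module K V] {𝒱 : ℤ → Submodule K V}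
  [DirectSum.Decomposition 𝒱]
  {W W₁ W₂ W₃ W₄ W₅ W₆ : Type*} [AddCommGroup W] [Module K W] [AddCommGroup W₁] [Module K W₁]
  [AddCommGroup W₂] [Module K W₂] [AddCommGroup W₃] [Module K W₃]
  [AddCommGroup W₄] [Module K W₄] [AddCommGroup W₅] [Module K W₅] [AddCommGroup W₆] [Module K W₆]

theorem contract_contract_sgn (g h : Σ i, 𝒱 i) (f : SymAlg 𝒱 →ₗ[K] W) :
    contract W h (contract W g f) = sgn K (g.1 * h.1) • contract W g (contract W h f) := by
  rw [contract_contract, negOnePow_smul (K := K)]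

/-- The value on a word of the convolution of two linear maps: the letters are distributed in all
ways among the two maps, with Koszul signs, and the remaining maps are combined by `τ`; here `c` is
the degree of the first map. -/
noncomputable def wordConv (τ : (SymAlg 𝒱 →ₗ[K] W₁) →ₗ[K] (SymAlg 𝒱 →ₗ[K] W₂) →ₗ[K] W₃) :
    List (Σ i, 𝒱 i) → ℤ → (SymAlg 𝒱 →ₗ[K] W₁) →ₗ[K] (SymAlg 𝒱 →ₗ[K] W₂) →ₗ[K] W₃
  | [], _ => τ
  | h :: l, c => (wordConv τ l (c + h.1)).comp (contract W₁ h) +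
      sgn K (h.1 * c) • (wordConv τ l c).compl₂ (contract W₂ h)

theorem wordConv_cons (τ : (SymAlg 𝒱 →ₗ[K] W₁) →ₗ[K] (SymAlg 𝒱 →ₗ[K] W₂) →ₗ[K] W₃)
    (h : Σ i, 𝒱 i) (l : List (Σ i, 𝒱 i)) (c : ℤ) (f : SymAlg 𝒱 →ₗ[K] W₁) (g : SymAlg 𝒱 →ₗ[K] W₂) :
    wordConv τ (h :: l) c f g = wordConv τ l (c + h.1) (contract W₁ h f) g +
      sgn K (h.1 * c) • wordConv τ l c f (contract W₂ h g) := rfl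

/-- Two exchanged letters that enter the same factor are handled by the symmetry of second
derivatives. If they enter different factors, the recursion itself supplies the sign. The induction
needs arbitrary `c`, `f`, `g`, since preceding letters contract the factors. -/
theorem isSymMultilinear_wordConv
    (τ : (SymAlg 𝒱 →ₗ[K] W₁) →ₗ[K] (SymAlg 𝒱 →ₗ[K] W₂) →ₗ[K] W₃)
    (c : ℤ) (f : SymAlg 𝒱 →ₗ[K] W₁) (g : SymAlg 𝒱 →ₗ[K] W₂) :
    IsSymMultilinear 𝒱 (fun l => wordConv τ l c f g) where
  add l₁ l₂ i x y := by
    induction l₁ generalizing c f g with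
    | nil =>
      simp only [List.nil_append, wordConv_cons, contract_add, LinearMap.add_apply, map_add,
        smul_add]
      abel
    | cons h l ih =>
      simp only [List.cons_append, wordConv_cons, ih, smul_add]
      abel
  smul l₁ l₂ i a x := by
    induction l₁ generalizing c f g with
    | nil =>
      simp only [List.nil_append, wordConv_cons, contract_smul, LinearMap.smul_apply, map_smul,
        smul_add, smul_comm a]
    | cons h l ih =>
      simp only [List.cons_append, wordConv_cons, ih, smul_add, smul_comm a]
  swap l₁ l₂ h k := by
    induction l₁ generalizing c f g with
    | nil =>
      simp only [List.nil_append, wordConv_cons, negOnePow_smul (K := K),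
        contract_contract_sgn h k, map_smul, LinearMap.smul_apply, smul_add, smul_smul,
        add_right_comm c k.1 h.1]
      rcases sgn_parity (K := K) h.1 with p | p <;> rcases sgn_parity (K := K) k.1 with q | q <;>
        simp only [p, q, mul_add, sgn_add] <;> module
    | cons h l ih =>
      simp only [List.cons_append, wordConv_cons, ih, smul_add, negOnePow_smul (K := K),
        smul_comm (sgn K (h.1 * c))]

/-- The convolution of linear maps out of the symmetric algebra with respect to `τ`. -/
noncomputable def conv (τ : (SymAlg 𝒱 →ₗ[K] W₁) →ₗ[K] (SymAlg 𝒱 →ₗ[K] W₂) →ₗ[K] W₃) (c : ℤ) :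
    (SymAlg 𝒱 →ₗ[K] W₁) →ₗ[K] (SymAlg 𝒱 →ₗ[K] W₂) →ₗ[K] SymAlg 𝒱 →ₗ[K] W₃ :=
  have hc := fun f g => (isSymMultilinear_wordConv τ c f g).exists_linearMap.choose_spec
  LinearMap.mk₂ K (fun f g => (isSymMultilinear_wordConv τ c f g).exists_linearMap.choose)
    (fun f f' g => symAlg_ext fun l => by
      rw [LinearMap.add_apply, hc, hc, hc, map_add, LinearMap.add_apply])
    (fun a f g => symAlg_ext fun l => by
      rw [LinearMap.smul_apply, hc, hc, map_smul, LinearMap.smul_apply])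
    (fun f g g' => symAlg_ext fun l => by
      rw [LinearMap.add_apply, hc, hc, hc, map_add])
    (fun a f g => symAlg_ext fun l => by
      rw [LinearMap.smul_apply, hc, hc, map_smul])

theorem conv_word (τ : (SymAlg 𝒱 →ₗ[K] W₁) →ₗ[K] (SymAlg 𝒱 →ₗ[K] W₂) →ₗ[K] W₃) (c : ℤ)
    (f : SymAlg 𝒱 →ₗ[K] W₁) (g : SymAlg 𝒱 →ₗ[K] W₂) (l : List (Σ i, 𝒱 i)) :
    conv τ c f g (word 𝒱 l) = wordConv τ l c f g :=
  (isSymMultilinear_wordConv τ c f g).exists_linearMap.choose_spec l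

theorem conv_nil (τ : (SymAlg 𝒱 →ₗ[K] W₁) →ₗ[K] (SymAlg 𝒱 →ₗ[K] W₂) →ₗ[K] W₃) (c : ℤ)
    (f : SymAlg 𝒱 →ₗ[K] W₁) (g : SymAlg 𝒱 →ₗ[K] W₂) :
    conv τ c f g (word 𝒱 []) = τ f g := conv_word τ c f g []

/-- The Leibniz rule for partial derivatives. Together with `conv_nil` it determines `conv`, and the
algebraic identities below use nothing else about it. -/
theorem contract_conv (τ : (SymAlg 𝒱 →ₗ[K] W₁) →ₗ[K] (SymAlg 𝒱 →ₗ[K] W₂) →ₗ[K] W₃) (c : ℤ)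
    (f : SymAlg 𝒱 →ₗ[K] W₁) (g : SymAlg 𝒱 →ₗ[K] W₂) (h : Σ i, 𝒱 i) :
    contract W₃ h (conv τ c f g) = conv τ (c + h.1) (contract W₁ h f) g +
      sgn K (h.1 * c) • conv τ c f (contract W₂ h g) := by
  refine symAlg_ext fun l => ?_
  rw [contract_word, conv_word, wordConv_cons, LinearMap.add_apply, LinearMap.smul_apply,
    conv_word, conv_word]

/-- The linear map `f` on the symmetric algebra has degree `c`. -/
def HasDegree (𝒲 : ℤ → Submodule K W) (c : ℤ) (f : SymAlg 𝒱 →ₗ[K] W) : Prop :=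
  ∀ l, f (word 𝒱 l) ∈ 𝒲 (wordDeg l + c)

section

variable {𝒲 : ℤ → Submodule K W} {𝒲₁ : ℤ → Submodule K W₁} {𝒲₂ : ℤ → Submodule K W₂}
  {𝒲₃ : ℤ → Submodule K W₃}

theorem HasDegree.contract {c : ℤ} {f : SymAlg 𝒱 →ₗ[K] W} (hf : HasDegree 𝒲 c f)
    (h : Σ i, 𝒱 i) : HasDegree 𝒲 (c + h.1) (contract W h f) := by
  intro l
  have := hf (h :: l)
  rw [wordDeg_cons] at this
  rw [contract_word]
  convert this using 2
  ring

omit [DirectSum.Decomposition 𝒱] in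
theorem HasDegree.nil {c : ℤ} {f : SymAlg 𝒱 →ₗ[K] W} (hf : HasDegree 𝒲 c f) :
    f (word 𝒱 []) ∈ 𝒲 c := by
  have := hf []
  rwa [wordDeg_nil, zero_add] at this

theorem HasDegree.conv {τ : (SymAlg 𝒱 →ₗ[K] W₁) →ₗ[K] (SymAlg 𝒱 →ₗ[K] W₂) →ₗ[K] W₃} {k : ℤ}
    (hτ : ∀ (a b : ℤ) (f : SymAlg 𝒱 →ₗ[K] W₁) (g : SymAlg 𝒱 →ₗ[K] W₂), HasDegree 𝒲₁ a f →
      HasDegree 𝒲₂ b g → τ f g ∈ 𝒲₃ (a + b + k))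
    {a b : ℤ} {f : SymAlg 𝒱 →ₗ[K] W₁} {g : SymAlg 𝒱 →ₗ[K] W₂} (hf : HasDegree 𝒲₁ a f)
    (hg : HasDegree 𝒲₂ b g) : HasDegree 𝒲₃ (a + b + k) (conv τ a f g) := by
  intro l
  rw [conv_word]
  induction l generalizing a b f g with
  | nil => rw [wordDeg_nil, zero_add]; exact hτ a b f g hf hg
  | cons h l ih =>
    rw [wordConv_cons, wordDeg_cons]
    refine Submodule.add_mem _ ?_ (Submodule.smul_mem _ _ ?_)
    · convert ih (hf.contract h) hg using 2
      ring
    · convert ih hf (hg.contract h) using 2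
      ring

end

/-! ### Products and Lie derivatives -/

/-- The product `α β` of two linear maps with respect to a bilinear pairing, where `b` is the degree
of `β`. -/
noncomputable def prodMap (μ : W₁ →ₗ[K] W₂ →ₗ[K] W₃) (b : ℤ) :
    (SymAlg 𝒱 →ₗ[K] W₁) →ₗ[K] (SymAlg 𝒱 →ₗ[K] W₂) →ₗ[K] SymAlg 𝒱 →ₗ[K] W₃ :=
  -- `conv` charges a letter for passing its first argument. In αβ a letter reaches α by passing β,
  -- so β is put first and the result is flipped.
  (conv (LinearMap.mk₂ K (fun β α => μ (α (word 𝒱 [])) (β (word 𝒱 [])))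
    (fun _ _ _ => by simp) (fun _ _ _ => by simp) (fun _ _ _ => by simp)
    (fun _ _ _ => by simp)) b).flip

theorem prodMap_nil (μ : W₁ →ₗ[K] W₂ →ₗ[K] W₃) (b : ℤ) (α : SymAlg 𝒱 →ₗ[K] W₁)
    (β : SymAlg 𝒱 →ₗ[K] W₂) :
    prodMap μ b α β (word 𝒱 []) = μ (α (word 𝒱 [])) (β (word 𝒱 [])) := conv_nil _ _ _ _

theorem contract_prodMap (μ : W₁ →ₗ[K] W₂ →ₗ[K] W₃) (b : ℤ) (α : SymAlg 𝒱 →ₗ[K] W₁)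
    (β : SymAlg 𝒱 →ₗ[K] W₂) (h : Σ i, 𝒱 i) :
    contract W₃ h (prodMap μ b α β) = prodMap μ (b + h.1) α (contract W₂ h β) +
      sgn K (h.1 * b) • prodMap μ b (contract W₁ h α) β := contract_conv _ _ _ _ _

theorem HasDegree.prodMap {𝒲₁ : ℤ → Submodule K W₁} {𝒲₂ : ℤ → Submodule K W₂}
    {𝒲₃ : ℤ → Submodule K W₃} {μ : W₁ →ₗ[K] W₂ →ₗ[K] W₃} {k : ℤ}
    (hμ : ∀ (a b : ℤ), ∀ x ∈ 𝒲₁ a, ∀ y ∈ 𝒲₂ b, μ x y ∈ 𝒲₃ (a + b + k))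
    {a b : ℤ} {α : SymAlg 𝒱 →ₗ[K] W₁} {β : SymAlg 𝒱 →ₗ[K] W₂} (hα : HasDegree 𝒲₁ a α)
    (hβ : HasDegree 𝒲₂ b β) : HasDegree 𝒲₃ (a + b + k) (prodMap μ b α β) := by
  rw [add_comm a b]
  refine HasDegree.conv (fun a b f g hf hg => ?_) hβ hα
  rw [add_comm a b]
  exact hμ b a _ hg.nil _ hf.nil

/-- The inclusion of `V` into its symmetric algebra. -/
noncomputable def vecMap (𝒱 : ℤ → Submodule K V) : V →ₗ[K] SymAlg 𝒱 where
  toFun v := symList 𝒱 [v]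
  map_add' := symList_append_cons_add 𝒱 [] []
  map_smul' := symList_append_cons_smul 𝒱 [] []

omit [DirectSum.Decomposition 𝒱] in
theorem vecMap_of_mem {i : ℤ} {v : V} (hv : v ∈ 𝒱 i) : vecMap 𝒱 v = word 𝒱 [⟨i, v, hv⟩] := rfl

theorem apply_vecMap (f : SymAlg 𝒱 →ₗ[K] W) {i : ℤ} {v : V} (hv : v ∈ 𝒱 i) :
    f (vecMap 𝒱 v) = contract W ⟨i, v, hv⟩ f (word 𝒱 []) := by
  rw [vecMap_of_mem hv, contract_word]

variable (W) in
/-- The derivative of `α` along the vector field `X` of degree `c`: the sum of all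
`± α (X (v₁, …) ⊙ v₂ ⊙ …)`. -/
noncomputable def lieDer (c : ℤ) :
    (SymAlg 𝒱 →ₗ[K] V) →ₗ[K] (SymAlg 𝒱 →ₗ[K] W) →ₗ[K] SymAlg 𝒱 →ₗ[K] W :=
  conv (LinearMap.mk₂ K (fun X α => α (vecMap 𝒱 (X (word 𝒱 []))))
    (fun _ _ _ => by simp) (fun _ _ _ => by simp) (fun _ _ _ => by simp)
    (fun _ _ _ => by simp)) c

theorem lieDer_nil (c : ℤ) (X : SymAlg 𝒱 →ₗ[K] V) (α : SymAlg 𝒱 →ₗ[K] W) :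
    lieDer W c X α (word 𝒱 []) = α (vecMap 𝒱 (X (word 𝒱 []))) := conv_nil _ _ _ _

theorem contract_lieDer (c : ℤ) (X : SymAlg 𝒱 →ₗ[K] V) (α : SymAlg 𝒱 →ₗ[K] W) (h : Σ i, 𝒱 i) :
    contract W h (lieDer W c X α) = lieDer W (c + h.1) (contract V h X) α +
      sgn K (h.1 * c) • lieDer W c X (contract W h α) := contract_conv _ _ _ _ _

theorem HasDegree.lieDer {𝒲 : ℤ → Submodule K W} {a c : ℤ} {X : SymAlg 𝒱 →ₗ[K] V}
    {α : SymAlg 𝒱 →ₗ[K] W} (hX : HasDegree 𝒱 c X) (hα : HasDegree 𝒲 a α) :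
    HasDegree 𝒲 (c + a) (lieDer W c X α) := by
  rw [← add_zero (c + a)]
  refine HasDegree.conv (fun a b f g hf hg => ?_) hX hα
  have := hg [⟨a, f (word 𝒱 []), hf.nil⟩]
  rw [wordDeg_cons, wordDeg_nil] at this
  rwa [add_right_comm]

/-! ### Identities -/

/-- The difference L_Z L_Y α − L_{L_Z Y} α is the second derivative of α in the directions Y and Z,
hence graded symmetric in them. -/
theorem lieDer_lieDer (l : List (Σ i, 𝒱 i)) (y z : ℤ) (Y Z : SymAlg 𝒱 →ₗ[K] V)
    (α : SymAlg 𝒱 →ₗ[K] W) (hY : HasDegree 𝒱 y Y) (hZ : HasDegree 𝒱 z Z) :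
    (lieDer W z Z (lieDer W y Y α) - lieDer W (y + z) (lieDer V z Z Y) α) (word 𝒱 l) =
      sgn K (y * z) • (lieDer W y Y (lieDer W z Z α) - lieDer W (z + y) (lieDer V y Y Z) α)
        (word 𝒱 l) := by
  induction l generalizing y z Y Z α with
  | nil =>
    simp only [LinearMap.sub_apply, lieDer_nil, apply_vecMap _ hY.nil, apply_vecMap _ hZ.nil,
      contract_lieDer, LinearMap.add_apply, LinearMap.smul_apply]
    rw [contract_contract_sgn ⟨z, _, hZ.nil⟩ ⟨y, _, hY.nil⟩]
    simp only [LinearMap.smul_apply]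
    rcases sgn_parity (K := K) y with p | p <;> rcases sgn_parity (K := K) z with q | q <;>
      simp only [p, q] <;> module
  | cons h l ih =>
    have h1 := ih y (z + h.1) Y (contract V h Z) α hY (hZ.contract h)
    have h2 := ih (y + h.1) z (contract V h Y) Z α (hY.contract h) hZ
    have h3 := ih y z Y Z (contract W h α) hY hZ
    rw [← contract_word, ← contract_word]
    simp only [map_sub, map_add, map_smul, contract_lieDer, LinearMap.add_apply,
      LinearMap.smul_apply, LinearMap.sub_apply, ← add_assoc y z, ← add_assoc z y,
      add_right_comm y h.1 z, add_right_comm z h.1 y] at h1 h2 h3 ⊢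
    -- The letter `h` goes to Z, to Y past Z, or to α past both. The later inductions distribute the
    -- letter over their factors in the same way.
    linear_combination (norm := skip) h1 + sgn K (h.1 * z) • h2 + sgn K (h.1 * (y + z)) • h3
    rcases sgn_parity (K := K) y with p | p <;> rcases sgn_parity (K := K) z with q | q <;>
      rcases sgn_parity (K := K) h.1 with r | r <;>
      simp only [p, q, r, mul_add, add_mul, sgn_add] <;> module

/-- At the empty word this is the Leibniz rule `contract_prodMap` in the direction Z(0). -/
theorem lieDer_prodMap (μ : W₁ →ₗ[K] W₂ →ₗ[K] W₃) (l : List (Σ i, 𝒱 i)) (z b : ℤ)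
    (Z : SymAlg 𝒱 →ₗ[K] V) (α : SymAlg 𝒱 →ₗ[K] W₁) (β : SymAlg 𝒱 →ₗ[K] W₂)
    (hZ : HasDegree 𝒱 z Z) :
    lieDer W₃ z Z (prodMap μ b α β) (word 𝒱 l) = (prodMap μ (b + z) α (lieDer W₂ z Z β) +
      sgn K (z * b) • prodMap μ b (lieDer W₁ z Z α) β) (word 𝒱 l) := by
  induction l generalizing z b Z α β with
  | nil =>
    simp only [LinearMap.add_apply, LinearMap.smul_apply, lieDer_nil, apply_vecMap _ hZ.nil,
      contract_prodMap, prodMap_nil]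
  | cons h l ih =>
    have h1 := ih (z + h.1) b (contract V h Z) α β (hZ.contract h)
    have h2 := ih z (b + h.1) Z α (contract W₂ h β) hZ
    have h3 := ih z b Z (contract W₁ h α) β hZ
    rw [← contract_word, ← contract_word]
    simp only [map_add, map_smul, contract_lieDer, contract_prodMap, LinearMap.add_apply,
      LinearMap.smul_apply, ← add_assoc b z,
      add_right_comm b h.1 z] at h1 h2 h3 ⊢
    linear_combination (norm := skip) h1 + sgn K (h.1 * z) • h2 + sgn K (h.1 * (b + z)) • h3
    rcases sgn_parity (K := K) b with p | p <;> rcases sgn_parity (K := K) z with q | q <;>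
      rcases sgn_parity (K := K) h.1 with r | r <;>
      simp only [p, q, r, mul_add, add_mul, sgn_add] <;> module

/-- The pairings are allowed to differ, so that both associativity of composition and the rule (fg)x
= f(gx) are instances. -/
theorem prodMap_assoc (μ : W₁ →ₗ[K] W₂ →ₗ[K] W₃) (ν : W₃ →ₗ[K] W₄ →ₗ[K] W₅)
    (μ' : W₁ →ₗ[K] W₆ →ₗ[K] W₅) (ν' : W₂ →ₗ[K] W₄ →ₗ[K] W₆)
    (H : ∀ x y z, ν (μ x y) z = μ' x (ν' y z)) (l : List (Σ i, 𝒱 i)) (b c : ℤ)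
    (α : SymAlg 𝒱 →ₗ[K] W₁) (β : SymAlg 𝒱 →ₗ[K] W₂) (γ : SymAlg 𝒱 →ₗ[K] W₄) :
    prodMap ν c (prodMap μ b α β) γ (word 𝒱 l) =
      prodMap μ' (b + c) α (prodMap ν' c β γ) (word 𝒱 l) := by
  induction l generalizing b c α β γ with
  | nil => simp only [prodMap_nil, H]
  | cons h l ih =>
    have h1 := ih b (c + h.1) α β (contract W₄ h γ)
    have h2 := ih (b + h.1) c α (contract W₂ h β) γ
    have h3 := ih b c (contract W₁ h α) β γ
    rw [← contract_word, ← contract_word]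
    simp only [map_add, map_smul, contract_prodMap, LinearMap.add_apply,
      LinearMap.smul_apply, ← add_assoc b c,
      add_right_comm b h.1 c] at h1 h2 h3 ⊢
    linear_combination (norm := skip) h1 + sgn K (h.1 * c) • h2 + sgn K (h.1 * (b + c)) • h3
    rcases sgn_parity (K := K) b with p | p <;> rcases sgn_parity (K := K) c with q | q <;>
      rcases sgn_parity (K := K) h.1 with r | r <;>
      simp only [p, q, r, mul_add, sgn_add] <;> module

end Convolution

/-! ### The Lie bracket and its derivations on the level of power series -/

section Bracket

variable {K V : Type*} [Field K] [AddCommGroup V] [Module K V] {𝒱 : ℤ → Submodule K V}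
  [DirectSum.Decomposition 𝒱] {br : V →ₗ[K] V →ₗ[K] V}

-- The cyclic form of the Leibniz rule, obtained by moving outer vectors with `symm`. In this form
-- the three terms coincide for equal arguments of degree 0.
omit [DirectSum.Decomposition 𝒱] in
theorem IsSymGradedLie.jacobi (hbr : IsSymGradedLie 𝒱 br) {i j k : ℤ} {x y z : V} (hx : x ∈ 𝒱 i)
    (hy : y ∈ 𝒱 j) (hz : z ∈ 𝒱 k) :
    br (br x y) z + sgn K (j * k) • br (br x z) y + sgn K (i * (j + k)) • br (br y z) x = 0 := by
  have h1 := hbr.leibniz i j k x y z hx hy hz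
  rw [hbr.symm i (j + k + 1) x _ hx (hbr.degree j k y z hy hz),
    hbr.symm j (i + k + 1) y _ hy (hbr.degree i k x z hx hz)] at h1
  simp only [negOnePow_smul (K := K)] at h1
  linear_combination (norm := skip) sgn K i • h1
  rcases sgn_parity (K := K) i with p | p <;> rcases sgn_parity (K := K) j with q | q <;>
    rcases sgn_parity (K := K) k with r | r <;>
    simp only [p, q, r, mul_add, add_mul, sgn_add, mul_one, one_mul, sgn_one] <;> module

theorem prodMap_bracket_comm (hbr : IsSymGradedLie 𝒱 br) (l : List (Σ i, 𝒱 i)) (x y : ℤ)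
    (X Y : SymAlg 𝒱 →ₗ[K] V) (hX : HasDegree 𝒱 x X) (hY : HasDegree 𝒱 y Y) :
    prodMap br y X Y (word 𝒱 l) = sgn K (x * y) • prodMap br x Y X (word 𝒱 l) := by
  induction l generalizing x y X Y with
  | nil => rw [prodMap_nil, prodMap_nil, hbr.symm x y _ _ hX.nil hY.nil, negOnePow_smul (K := K)]
  | cons h l ih =>
    have h1 := ih x (y + h.1) X (contract V h Y) hX (hY.contract h)
    have h2 := ih (x + h.1) y (contract V h X) Y (hX.contract h) hY
    rw [← contract_word, ← contract_word]
    simp only [contract_prodMap, LinearMap.add_apply, LinearMap.smul_apply]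
    linear_combination (norm := skip) h1 + sgn K (h.1 * y) • h2
    rcases sgn_parity (K := K) x with p | p <;> rcases sgn_parity (K := K) y with q | q <;>
      rcases sgn_parity (K := K) h.1 with r | r <;>
      simp only [p, q, r, mul_add, add_mul, sgn_add] <;> module

theorem prodMap_bracket_jacobi (hbr : IsSymGradedLie 𝒱 br) (l : List (Σ i, 𝒱 i)) (x y z : ℤ)
    (X Y Z : SymAlg 𝒱 →ₗ[K] V) (hX : HasDegree 𝒱 x X) (hY : HasDegree 𝒱 y Y)
    (hZ : HasDegree 𝒱 z Z) :
    (prodMap br z (prodMap br y X Y) Z + sgn K (y * z) • prodMap br y (prodMap br z X Z) Y +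
      sgn K (x * (y + z)) • prodMap br x (prodMap br z Y Z) X) (word 𝒱 l) = 0 := by
  induction l generalizing x y z X Y Z with
  | nil =>
    simp only [LinearMap.add_apply, LinearMap.smul_apply, prodMap_nil]
    exact hbr.jacobi hX.nil hY.nil hZ.nil
  | cons h l ih =>
    have h1 := ih x y (z + h.1) X Y (contract V h Z) hX hY (hZ.contract h)
    have h2 := ih x (y + h.1) z X (contract V h Y) Z hX (hY.contract h) hZ
    have h3 := ih (x + h.1) y z (contract V h X) Y Z (hX.contract h) hY hZ
    rw [← contract_word]
    simp only [map_add, map_smul, contract_prodMap, LinearMap.add_apply,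
      LinearMap.smul_apply] at h1 h2 h3 ⊢
    linear_combination (norm := skip) h1 + sgn K (h.1 * z) • h2 + sgn K (h.1 * (y + z)) • h3
    rcases sgn_parity (K := K) x with o | o <;> rcases sgn_parity (K := K) y with p | p <;>
      rcases sgn_parity (K := K) z with q | q <;> rcases sgn_parity (K := K) h.1 with r | r <;>
      simp only [o, p, q, r, mul_add, add_mul, sgn_add] <;> module

/-- The evaluation pairing. -/
def evalMap (K V : Type*) [Field K] [AddCommGroup V] [Module K V] :
    Module.End K V →ₗ[K] V →ₗ[K] V := LinearMap.id

/-- At the empty word this is the derivation rule for β(0), and contractions of β are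
derivation-valued again. -/
theorem prodMap_eval_bracket (l : List (Σ i, 𝒱 i)) (b x y : ℤ)
    (β : SymAlg 𝒱 →ₗ[K] Module.End K V) (X Y : SymAlg 𝒱 →ₗ[K] V)
    (hβ : HasDegree (derDeg 𝒱 br) b β) (hX : HasDegree 𝒱 x X) (hY : HasDegree 𝒱 y Y) :
    prodMap (evalMap K V) (x + y + 1) β (prodMap br y X Y) (word 𝒱 l) =
      (sgn K b • prodMap br y (prodMap (evalMap K V) x β X) Y +
        sgn K (b * (x + 1)) • prodMap br (b + y) X (prodMap (evalMap K V) y β Y)) (word 𝒱 l) := by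
  induction l generalizing b x y β X Y with
  | nil =>
    simp only [LinearMap.add_apply, LinearMap.smul_apply, prodMap_nil]
    have := hβ.nil.2 x y _ _ hX.nil hY.nil
    rwa [negOnePow_smul (K := K), negOnePow_smul (K := K)] at this
  | cons h l ih =>
    have h1 := ih b x (y + h.1) β X (contract V h Y) hβ hX (hY.contract h)
    have h2 := ih b (x + h.1) y β (contract V h X) Y hβ (hX.contract h) hY
    have h3 := ih (b + h.1) x y (contract _ h β) X Y (hβ.contract h) hX hY
    rw [← contract_word, ← contract_word]
    simp only [map_add, map_smul, contract_prodMap, LinearMap.add_apply, LinearMap.smul_apply,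
      ← add_assoc x y, ← add_assoc b y, add_right_comm _ h.1 y, add_right_comm _ h.1 (1 : ℤ)]
        at h1 h2 h3 ⊢
    linear_combination (norm := skip) h1 + sgn K (h.1 * y) • h2 + sgn K (h.1 * (x + y + 1)) • h3
    rcases sgn_parity (K := K) x with o | o <;> rcases sgn_parity (K := K) y with p | p <;>
      rcases sgn_parity (K := K) b with q | q <;> rcases sgn_parity (K := K) h.1 with r | r <;>
      simp only [o, p, q, r, mul_add, add_mul, sgn_add, mul_one, one_mul] <;> module

/-! ### The projection onto `V` -/

theorem exists_projMap (𝒱 : ℤ → Submodule K V) [DirectSum.Decomposition 𝒱] :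
    ∃ F : SymAlg 𝒱 →ₗ[K] V, ∀ l, F (word 𝒱 l) =
      (match l with | [h] => (h.2 : V) | _ => 0 : V) := by
  refine IsSymMultilinear.exists_linearMap ⟨fun l₁ l₂ i x y => ?_, fun l₁ l₂ i c x => ?_,
    fun l₁ l₂ g h => ?_⟩
  · rcases l₁ with _ | ⟨a, _ | ⟨b, l⟩⟩ <;> rcases l₂ with _ | ⟨a', l'⟩ <;> simp
  · rcases l₁ with _ | ⟨a, _ | ⟨b, l⟩⟩ <;> rcases l₂ with _ | ⟨a', l'⟩ <;> simp
  · rcases l₁ with _ | ⟨a, _ | ⟨b, l⟩⟩ <;> simp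

/-- The projection of the symmetric algebra onto `V`. -/
noncomputable def projMap (𝒱 : ℤ → Submodule K V) [DirectSum.Decomposition 𝒱] :
    SymAlg 𝒱 →ₗ[K] V := (exists_projMap 𝒱).choose

theorem projMap_nil : projMap 𝒱 (word 𝒱 []) = 0 := (exists_projMap 𝒱).choose_spec []

theorem projMap_singleton (h : Σ i, 𝒱 i) : projMap 𝒱 (word 𝒱 [h]) = h.2 :=
  (exists_projMap 𝒱).choose_spec [h]

theorem projMap_cons_cons (g h : Σ i, 𝒱 i) (l : List (Σ i, 𝒱 i)) :
    projMap 𝒱 (word 𝒱 (g :: h :: l)) = 0 := (exists_projMap 𝒱).choose_spec (g :: h :: l)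

theorem projMap_vecMap (v : V) : projMap 𝒱 (vecMap 𝒱 v) = v := by
  refine DirectSum.Decomposition.inductionOn 𝒱 (motive := fun v => projMap 𝒱 (vecMap 𝒱 v) = v)
    ?_ (fun {i} m => projMap_singleton ⟨i, m⟩) (fun x y hx hy => ?_) v
  · simp
  · rw [map_add, map_add, hx, hy]

theorem contract_contract_projMap (g h : Σ i, 𝒱 i) :
    contract V h (contract V g (projMap 𝒱)) = 0 :=
  symAlg_ext fun l => by rw [contract_word, contract_word, projMap_cons_cons, LinearMap.zero_apply]

theorem hasDegree_projMap : HasDegree 𝒱 0 (projMap 𝒱) := by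
  rintro (_ | ⟨h, _ | ⟨g, l⟩⟩)
  · rw [projMap_nil]; exact Submodule.zero_mem _
  · rw [projMap_singleton, wordDeg_cons, wordDeg_nil, add_zero, add_zero]
    exact h.2.2
  · rw [projMap_cons_cons]; exact Submodule.zero_mem _

theorem lieDer_eq_zero {W : Type*} [AddCommGroup W] [Module K W] {c : ℤ} {X : SymAlg 𝒱 →ₗ[K] V}
    (hX : HasDegree 𝒱 c X) {α : SymAlg 𝒱 →ₗ[K] W} (hα : ∀ h, contract W h α = 0) :
    lieDer W c X α = 0 := by
  refine symAlg_ext fun l => ?_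
  induction l generalizing c X with
  | nil => rw [lieDer_nil, apply_vecMap _ hX.nil, hα]
  | cons h l ih =>
    rw [← contract_word, contract_lieDer, hα, map_zero, smul_zero, add_zero, ih (hX.contract h)]
    rfl

/-- As a power series `projMap` is x ↦ x, whose derivative along X is X. Its second derivatives
vanish, so only the term contracting X survives the induction. -/
theorem lieDer_projMap {c : ℤ} {X : SymAlg 𝒱 →ₗ[K] V} (hX : HasDegree 𝒱 c X) :
    lieDer V c X (projMap 𝒱) = X := by
  refine symAlg_ext fun l => ?_
  induction l generalizing c X with
  | nil => rw [lieDer_nil, projMap_vecMap]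
  | cons h l ih =>
    rw [← contract_word, contract_lieDer,
      lieDer_eq_zero hX (fun g => contract_contract_projMap h g), smul_zero, add_zero,
      ih (hX.contract h), contract_word]

/-! ### Cochains as vector fields -/

/-- The quadratic vector field defined by the bracket. -/
noncomputable def quadMap (𝒱 : ℤ → Submodule K V) [DirectSum.Decomposition 𝒱]
    (br : V →ₗ[K] V →ₗ[K] V) : SymAlg 𝒱 →ₗ[K] V :=
  (2⁻¹ : K) • prodMap br 0 (projMap 𝒱) (projMap 𝒱)

omit [DirectSum.Decomposition 𝒱] in
theorem HasDegree.smul {W : Type*} [AddCommGroup W] [Module K W] {𝒲 : ℤ → Submodule K W} {c : ℤ}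
    {f : SymAlg 𝒱 →ₗ[K] W} (hf : HasDegree 𝒲 c f) (a : K) : HasDegree 𝒲 c (a • f) :=
  fun l => Submodule.smul_mem _ a (hf l)

omit [DirectSum.Decomposition 𝒱] in
theorem HasDegree.add {W : Type*} [AddCommGroup W] [Module K W] {𝒲 : ℤ → Submodule K W} {c : ℤ}
    {f g : SymAlg 𝒱 →ₗ[K] W} (hf : HasDegree 𝒲 c f) (hg : HasDegree 𝒲 c g) :
    HasDegree 𝒲 c (f + g) :=
  fun l => Submodule.add_mem _ (hf l) (hg l)

theorem hasDegree_quadMap (hbr : IsSymGradedLie 𝒱 br) : HasDegree 𝒱 1 (quadMap 𝒱 br) := by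
  have := (hasDegree_projMap (𝒱 := 𝒱)).prodMap (μ := br) (k := 1)
    (fun a b x hx y hy => hbr.degree a b x y hx hy) hasDegree_projMap
  exact HasDegree.smul (by simpa using this) _

/-- The two Leibniz terms agree by symmetry of the bracket, which cancels the factor ½. -/
theorem lieDer_quadMap [CharZero K] (hbr : IsSymGradedLie 𝒱 br) {c : ℤ} {X : SymAlg 𝒱 →ₗ[K] V}
    (hX : HasDegree 𝒱 c X) :
    lieDer V c X (quadMap 𝒱 br) = prodMap br 0 X (projMap 𝒱) := by
  have h1 : lieDer V c X (prodMap br 0 (projMap 𝒱) (projMap 𝒱)) =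
      (2 : K) • prodMap br 0 X (projMap 𝒱) := by
    refine symAlg_ext fun l => ?_
    rw [lieDer_prodMap _ _ _ _ _ _ _ hX, lieDer_projMap hX, LinearMap.add_apply, zero_add,
      prodMap_bracket_comm hbr l 0 c _ _ hasDegree_projMap hX, LinearMap.smul_apply,
      zero_mul, mul_zero, sgn_zero, LinearMap.smul_apply, two_smul, one_smul]
  rw [quadMap, map_smul, h1, smul_smul, inv_mul_cancel₀ two_ne_zero, one_smul]

/-- L_Q Q is half of [[x,x],x], and the Jacobi identity at three equal arguments says that three
times this cubic vanishes. No signs occur since `projMap` has degree 0. -/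
theorem lieDer_quadMap_self [CharZero K] (hbr : IsSymGradedLie 𝒱 br) :
    lieDer V 1 (quadMap 𝒱 br) (quadMap 𝒱 br) = 0 := by
  rw [lieDer_quadMap hbr (hasDegree_quadMap hbr)]
  refine symAlg_ext fun l => ?_
  have h := prodMap_bracket_jacobi hbr l 0 0 0 _ _ _ hasDegree_projMap hasDegree_projMap
    hasDegree_projMap
  simp only [zero_mul, sgn_zero, one_smul, LinearMap.add_apply] at h
  have h' : (3 : K) • prodMap br 0 (prodMap br 0 (projMap 𝒱) (projMap 𝒱)) (projMap 𝒱) (word 𝒱 l)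
      = 0 := by
    rw [← h]; module
  rw [smul_eq_zero] at h'
  rw [quadMap, map_smul, LinearMap.smul_apply, LinearMap.smul_apply,
    h'.resolve_left three_ne_zero, smul_zero, LinearMap.zero_apply]

/-- The vector field `x ↦ α(x) x` defined by a cochain `α`. -/
noncomputable def vfMap (𝒱 : ℤ → Submodule K V) [DirectSum.Decomposition 𝒱] :
    (SymAlg 𝒱 →ₗ[K] Module.End K V) →ₗ[K] SymAlg 𝒱 →ₗ[K] V :=
  (prodMap (evalMap K V) 0).flip (projMap 𝒱)

theorem vfMap_apply (α : SymAlg 𝒱 →ₗ[K] Module.End K V) :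
    vfMap 𝒱 α = prodMap (evalMap K V) 0 α (projMap 𝒱) := rfl

theorem HasDegree.vfMap {a : ℤ} {α : SymAlg 𝒱 →ₗ[K] Module.End K V}
    (hα : HasDegree (derDeg 𝒱 br) a α) : HasDegree 𝒱 a (vfMap 𝒱 α) := by
  have := hα.prodMap (μ := evalMap K V) (k := 0)
    (fun a b f hf x hx => by rw [add_zero, add_comm]; exact hf.1 b x hx) hasDegree_projMap
  rwa [add_zero, add_zero] at this

/-- A derivation β(x) sends [x,x] to two equal terms ±[β(x)x, x]. This is where derivation values
are needed for compatibility with the differential. -/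
theorem lieDer_vfMap_quadMap [CharZero K] (hbr : IsSymGradedLie 𝒱 br) {b : ℤ}
    {β : SymAlg 𝒱 →ₗ[K] Module.End K V} (hβ : HasDegree (derDeg 𝒱 br) b β) :
    lieDer V b (vfMap 𝒱 β) (quadMap 𝒱 br) =
      sgn K b • prodMap (evalMap K V) 1 β (quadMap 𝒱 br) := by
  rw [lieDer_quadMap hbr hβ.vfMap, quadMap, map_smul]
  refine symAlg_ext fun l => ?_
  have h := prodMap_eval_bracket l b 0 0 β _ _ hβ hasDegree_projMap hasDegree_projMap
  rw [LinearMap.add_apply, LinearMap.smul_apply, LinearMap.smul_apply, ← vfMap_apply, zero_add,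
    zero_add, mul_one, add_zero,
    prodMap_bracket_comm hbr l 0 b _ _ hasDegree_projMap hβ.vfMap, zero_mul, sgn_zero, one_smul,
    ← two_smul K (sgn K b • _)] at h
  rw [LinearMap.smul_apply, LinearMap.smul_apply, h, smul_smul (2⁻¹ : K),
    inv_mul_cancel₀ two_ne_zero, one_smul, smul_smul, sgn_mul_self, one_smul]

/-! ### The pre-Lie product -/

/-- The right pre-Lie product of linear maps into the endomorphisms of `V`, where `b` is the degree
of the second factor. -/
noncomputable def preLie (𝒱 : ℤ → Submodule K V) [DirectSum.Decomposition 𝒱] (b : ℤ) :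
    (SymAlg 𝒱 →ₗ[K] Module.End K V) →ₗ[K] (SymAlg 𝒱 →ₗ[K] Module.End K V) →ₗ[K]
      SymAlg 𝒱 →ₗ[K] Module.End K V :=
  ((lieDer (Module.End K V) b).comp (vfMap 𝒱)).flip + prodMap (LinearMap.mul K (Module.End K V)) b

theorem preLie_apply (b : ℤ) (α β : SymAlg 𝒱 →ₗ[K] Module.End K V) :
    preLie 𝒱 b α β = lieDer _ b (vfMap 𝒱 β) α + prodMap (LinearMap.mul K _) b α β := rfl

/-- Differentiate β(x)x along vf(γ): differentiating β gives the Lie derivative term of ◁, and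
differentiating x gives β(x)γ(x)x, the product term. -/
theorem vfMap_preLie {c : ℤ} {β γ : SymAlg 𝒱 →ₗ[K] Module.End K V}
    (hγ : HasDegree 𝒱 c (vfMap 𝒱 γ)) :
    vfMap 𝒱 (preLie 𝒱 c β γ) = lieDer V c (vfMap 𝒱 γ) (vfMap 𝒱 β) := by
  refine symAlg_ext fun l => ?_
  rw [vfMap_apply β, lieDer_prodMap _ _ _ _ _ _ _ hγ, preLie_apply, map_add, mul_zero, sgn_zero,
    one_smul, LinearMap.add_apply, LinearMap.add_apply, add_comm, vfMap_apply,
    prodMap_assoc _ _ (evalMap K V) (evalMap K V) (fun _ _ _ => rfl), lieDer_projMap hγ, add_zero,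
    zero_add]
  rfl

/-- The associator of ◁ consists of the second derivative of α along vf(β) and vf(γ), symmetric by
`lieDer_lieDer`, and of the cross terms (L_{vf β} α)γ and ±(L_{vf γ} α)β, which are exchanged. The
other terms cancel by the Leibniz rule and associativity. -/
theorem preLie_symm {b c : ℤ} {α β γ : SymAlg 𝒱 →ₗ[K] Module.End K V}
    (hβ : HasDegree 𝒱 b (vfMap 𝒱 β)) (hγ : HasDegree 𝒱 c (vfMap 𝒱 γ)) :
    preLie 𝒱 c (preLie 𝒱 b α β) γ - preLie 𝒱 (b + c) α (preLie 𝒱 c β γ) =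
      sgn K (b * c) • (preLie 𝒱 b (preLie 𝒱 c α γ) β - preLie 𝒱 (c + b) α (preLie 𝒱 b γ β)) := by
  refine symAlg_ext fun l => ?_
  have h1 := lieDer_lieDer l b c _ _ α hβ hγ
  have h2 := lieDer_prodMap (LinearMap.mul K (Module.End K V)) l c b _ α β hγ
  have h3 := lieDer_prodMap (LinearMap.mul K (Module.End K V)) l b c _ α γ hβ
  have h4 := prodMap_assoc (LinearMap.mul K (Module.End K V)) (LinearMap.mul K _)
    (LinearMap.mul K _) (LinearMap.mul K _) (fun x y z => mul_assoc x y z) l b c α β γ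
  have h5 := prodMap_assoc (LinearMap.mul K (Module.End K V)) (LinearMap.mul K _)
    (LinearMap.mul K _) (LinearMap.mul K _) (fun x y z => mul_assoc x y z) l c b α γ β
  simp only [preLie_apply _ α, preLie_apply _ (_ + _), vfMap_preLie hβ, vfMap_preLie hγ]
  simp only [preLie_apply, map_add, LinearMap.add_apply, LinearMap.sub_apply,
    LinearMap.smul_apply] at h1 h2 h3 h4 h5 ⊢
  linear_combination (norm := skip) h1 + h2 + h4 - sgn K (b * c) • h3 - sgn K (b * c) • h5
  rcases sgn_parity (K := K) b with p | p <;> rcases sgn_parity (K := K) c with q | q <;>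
    simp only [p, q] <;> module

/-- Both L_{vf β} Q and L_Q vf(β) contain the term βQ. It cancels in `lieDer_lieDer`, and of the
commutator of Q and vf(β) only vf(L_Q β) remains. -/
theorem lieDer_quadMap_preLie [CharZero K] (hbr : IsSymGradedLie 𝒱 br) {b : ℤ}
    {α β : SymAlg 𝒱 →ₗ[K] Module.End K V} (hβ : HasDegree (derDeg 𝒱 br) b β) :
    lieDer _ 1 (quadMap 𝒱 br) (preLie 𝒱 b α β) =
      sgn K b • preLie 𝒱 b (lieDer _ 1 (quadMap 𝒱 br) α) β +
        preLie 𝒱 (b + 1) α (lieDer _ 1 (quadMap 𝒱 br) β) := by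
  have hQ := hasDegree_quadMap hbr
  refine symAlg_ext fun l => ?_
  have h1 := lieDer_lieDer l b 1 _ _ α hβ.vfMap hQ
  have h2 := lieDer_prodMap (LinearMap.mul K (Module.End K V)) l 1 b _ α β hQ
  have h3 : lieDer V 1 (quadMap 𝒱 br) (vfMap 𝒱 β) =
      prodMap (evalMap K V) 1 β (quadMap 𝒱 br) + vfMap 𝒱 (lieDer _ 1 (quadMap 𝒱 br) β) := by
    refine symAlg_ext fun l => ?_
    rw [vfMap_apply, lieDer_prodMap _ _ _ _ _ _ _ hQ, lieDer_projMap hQ, mul_zero, sgn_zero,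
      one_smul, zero_add]
    rfl
  rw [lieDer_vfMap_quadMap hbr hβ, h3, add_comm (1 : ℤ) b] at h1
  simp only [preLie_apply, map_add, map_smul, LinearMap.add_apply, LinearMap.sub_apply,
    LinearMap.smul_apply, mul_one, one_mul] at h1 h2 ⊢
  linear_combination (norm := skip) h1 + h2
  rcases sgn_parity (K := K) b with p | p <;> simp only [p] <;> module

end Bracket

/-! ### The graded Lie bracket and differential on derivation-valued cochains -/

section CochainLie

variable {K V : Type*} [Field K] [AddCommGroup V] [Module K V] {𝒱 : ℤ → Submodule K V}
  {br : V →ₗ[K] V →ₗ[K] V}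

theorem gradedComm_mem_derDeg {a b : ℤ} {A B : Module.End K V} (hA : A ∈ derDeg 𝒱 br a)
    (hB : B ∈ derDeg 𝒱 br b) : gradedComm a b A B ∈ derDeg 𝒱 br (a + b) := by
  refine ⟨fun i x hx => ?_, fun i j x y hx hy => ?_⟩
  · have h1 := hA.1 _ _ (hB.1 i x hx)
    have h2 := hB.1 _ _ (hA.1 i x hx)
    rw [add_assoc, add_comm b a] at h1
    rw [add_assoc] at h2
    simp only [gradedComm, negOnePow_smul (K := K), LinearMap.sub_apply, LinearMap.smul_apply,
      Module.End.mul_apply]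
    exact Submodule.sub_mem _ h1 (Submodule.smul_mem _ _ h2)
  · have e1 := hA.2 (i + b) j (B x) y (hB.1 i x hx) hy
    have e2 := hA.2 i (j + b) x (B y) hx (hB.1 j y hy)
    have e3 := hB.2 (i + a) j (A x) y (hA.1 i x hx) hy
    have e4 := hB.2 i (j + a) x (A y) hx (hA.1 j y hy)
    simp only [gradedComm, negOnePow_smul (K := K), LinearMap.sub_apply, LinearMap.smul_apply,
      Module.End.mul_apply, hA.2 i j x y hx hy, hB.2 i j x y hx hy, map_add, map_sub, map_smul]
      at e1 e2 e3 e4 ⊢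
    rw [e1, e2, e3, e4]
    rcases sgn_parity (K := K) a with p | p <;> rcases sgn_parity (K := K) b with q | q <;>
      rcases sgn_parity (K := K) i with r | r <;>
      simp only [p, q, r, mul_add, add_mul, sgn_add, mul_one, one_mul] <;> module

variable [DirectSum.Decomposition 𝒱]

/-- A single product αβ need not have derivation values, so the induction carries the whole
commutator; contracting one factor produces commutators again. -/
theorem HasDegree.gradedComm {a b : ℤ} {α β : SymAlg 𝒱 →ₗ[K] Module.End K V}
    (hα : HasDegree (derDeg 𝒱 br) a α) (hβ : HasDegree (derDeg 𝒱 br) b β) :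
    HasDegree (derDeg 𝒱 br) (a + b)
      (OpPostLie.prodMap (LinearMap.mul K (Module.End K V)) b α β -
        sgn K (a * b) • OpPostLie.prodMap (LinearMap.mul K (Module.End K V)) a β α) := by
  intro l
  induction l generalizing a b α β with
  | nil =>
    have h := gradedComm_mem_derDeg hα.nil hβ.nil
    rw [OpPostLie.gradedComm, negOnePow_smul (K := K)] at h
    rw [LinearMap.sub_apply, LinearMap.smul_apply, prodMap_nil, prodMap_nil, wordDeg_nil, zero_add]
    exact h
  | cons h l ih =>
    have h1 := ih hα (hβ.contract h)
    have h2 := Submodule.smul_mem _ (sgn K (h.1 * b)) (ih (hα.contract h) hβ)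
    rw [← contract_word]
    have e1 : wordDeg l + (a + (b + h.1)) = wordDeg (h :: l) + (a + b) := by
      rw [wordDeg_cons]; ring
    have e2 : wordDeg l + (a + h.1 + b) = wordDeg (h :: l) + (a + b) := by
      rw [wordDeg_cons]; ring
    rw [e1] at h1
    rw [e2] at h2
    convert Submodule.add_mem _ h1 h2 using 1
    simp only [map_sub, map_smul, contract_prodMap, LinearMap.sub_apply, LinearMap.smul_apply,
      LinearMap.add_apply]
    rcases sgn_parity (K := K) a with p | p <;> rcases sgn_parity (K := K) b with q | q <;>
      rcases sgn_parity (K := K) h.1 with r | r <;>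
      simp only [p, q, r, mul_add, add_mul, sgn_add] <;> module

/-- The bracket `[α, β]^c` of cochains of degrees `a` and `b` in the suspended complex. -/
noncomputable def lieBr (𝒱 : ℤ → Submodule K V) [DirectSum.Decomposition 𝒱] (a b : ℤ) :
    (SymAlg 𝒱 →ₗ[K] Module.End K V) →ₗ[K] (SymAlg 𝒱 →ₗ[K] Module.End K V) →ₗ[K]
      SymAlg 𝒱 →ₗ[K] Module.End K V :=
  (-1 : K) • preLie 𝒱 b + sgn K (a * b) • (preLie 𝒱 a).flip

theorem lieBr_apply (a b : ℤ) (α β : SymAlg 𝒱 →ₗ[K] Module.End K V) :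
    lieBr 𝒱 a b α β = -preLie 𝒱 b α β + sgn K (a * b) • preLie 𝒱 a β α := by
  rw [← neg_one_smul K (preLie 𝒱 b α β)]; rfl

/-- The differential `∂` of cochains of degree `a` in the suspended complex. -/
noncomputable def cochainDiff (𝒱 : ℤ → Submodule K V) [DirectSum.Decomposition 𝒱]
    (br : V →ₗ[K] V →ₗ[K] V) (a : ℤ) :
    (SymAlg 𝒱 →ₗ[K] Module.End K V) →ₗ[K] SymAlg 𝒱 →ₗ[K] Module.End K V :=
  sgn K a • lieDer (Module.End K V) 1 (quadMap 𝒱 br)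

theorem cochainDiff_apply (a : ℤ) (α : SymAlg 𝒱 →ₗ[K] Module.End K V) :
    cochainDiff 𝒱 br a α = sgn K a • lieDer (Module.End K V) 1 (quadMap 𝒱 br) α := rfl

/-- Lie derivatives preserve derivation values, and the two remaining product terms form a graded
commutator. -/
theorem HasDegree.lieBr {a b : ℤ} {α β : SymAlg 𝒱 →ₗ[K] Module.End K V}
    (hα : HasDegree (derDeg 𝒱 br) a α) (hβ : HasDegree (derDeg 𝒱 br) b β) :
    HasDegree (derDeg 𝒱 br) (a + b) (lieBr 𝒱 a b α β) := by
  have h1 := (hβ.vfMap.lieDer hα).smul (-1)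
  have h2 := (hα.vfMap.lieDer hβ).smul (sgn K (a * b))
  have h3 := (HasDegree.gradedComm hα hβ).smul (-1)
  rw [add_comm b a] at h1
  convert (h1.add h2).add h3 using 1
  rw [lieBr_apply, preLie_apply, preLie_apply]
  module

theorem HasDegree.cochainDiff (hbr : IsSymGradedLie 𝒱 br) {a : ℤ}
    {α : SymAlg 𝒱 →ₗ[K] Module.End K V} (hα : HasDegree (derDeg 𝒱 br) a α) :
    HasDegree (derDeg 𝒱 br) (a + 1) (cochainDiff 𝒱 br a α) := by
  rw [add_comm]
  exact ((hasDegree_quadMap hbr).lieDer hα).smul _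

theorem lieBr_skew (a b : ℤ) (α β : SymAlg 𝒱 →ₗ[K] Module.End K V) :
    lieBr 𝒱 a b α β = -(sgn K (a * b) • lieBr 𝒱 b a β α) := by
  rw [lieBr_apply, lieBr_apply, mul_comm b a, smul_add, smul_smul, sgn_mul_self]
  module

/-- The passage from pre-Lie to Lie: Jacobi is a signed sum of the pre-Lie identities with α, β and
γ in turn as the leftmost factor. -/
theorem lieBr_jacobi {a b c : ℤ} {α β γ : SymAlg 𝒱 →ₗ[K] Module.End K V}
    (hα : HasDegree (derDeg 𝒱 br) a α) (hβ : HasDegree (derDeg 𝒱 br) b β)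
    (hγ : HasDegree (derDeg 𝒱 br) c γ) :
    lieBr 𝒱 a (b + c) α (lieBr 𝒱 b c β γ) = lieBr 𝒱 (a + b) c (lieBr 𝒱 a b α β) γ +
      sgn K (a * b) • lieBr 𝒱 b (a + c) β (lieBr 𝒱 a c α γ) := by
  have h1 := preLie_symm (α := α) hβ.vfMap hγ.vfMap
  have h2 := preLie_symm (α := β) hα.vfMap hγ.vfMap
  have h3 := preLie_symm (α := γ) hα.vfMap hβ.vfMap
  simp only [lieBr_apply, map_add, map_neg, map_smul, LinearMap.add_apply, LinearMap.neg_apply,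
    LinearMap.smul_apply]
  rw [add_comm c b] at h1
  rw [add_comm c a] at h2
  rw [add_comm b a] at h3
  linear_combination (norm := skip) -h1 + sgn K (a * b) • h2 -
    (sgn K (a * c) * sgn K (b * c)) • h3
  rcases sgn_parity (K := K) a with p | p <;> rcases sgn_parity (K := K) b with q | q <;>
    rcases sgn_parity (K := K) c with r | r <;>
    simp only [p, q, r, mul_add, add_mul, sgn_add] <;> module

theorem lieDer_quadMap_lieDer_quadMap [CharZero K] (hbr : IsSymGradedLie 𝒱 br)
    (α : SymAlg 𝒱 →ₗ[K] Module.End K V) :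
    lieDer _ 1 (quadMap 𝒱 br) (lieDer _ 1 (quadMap 𝒱 br) α) = 0 := by
  refine symAlg_ext fun l => ?_
  have hQ := hasDegree_quadMap hbr
  have h := lieDer_lieDer l 1 1 _ _ α hQ hQ
  rw [lieDer_quadMap_self hbr, map_zero, LinearMap.zero_apply, sub_zero, mul_one, sgn_one,
    neg_one_smul, eq_neg_iff_add_eq_zero, ← two_smul K] at h
  exact (smul_eq_zero.1 h).resolve_left two_ne_zero

theorem cochainDiff_cochainDiff [CharZero K] (hbr : IsSymGradedLie 𝒱 br) (a b : ℤ)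
    (α : SymAlg 𝒱 →ₗ[K] Module.End K V) :
    cochainDiff 𝒱 br b (cochainDiff 𝒱 br a α) = 0 := by
  rw [cochainDiff_apply, cochainDiff_apply, map_smul, lieDer_quadMap_lieDer_quadMap hbr,
    smul_zero, smul_zero]

/-- L_Q is a derivation of ◁ with signs for an operator acting from the right; the factor `sgn K a`
in `cochainDiff` converts them to the left convention. -/
theorem cochainDiff_lieBr [CharZero K] (hbr : IsSymGradedLie 𝒱 br) {a b : ℤ}
    {α β : SymAlg 𝒱 →ₗ[K] Module.End K V} (hα : HasDegree (derDeg 𝒱 br) a α)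
    (hβ : HasDegree (derDeg 𝒱 br) b β) :
    cochainDiff 𝒱 br (a + b) (lieBr 𝒱 a b α β) =
      lieBr 𝒱 (a + 1) b (cochainDiff 𝒱 br a α) β +
        sgn K a • lieBr 𝒱 a (b + 1) α (cochainDiff 𝒱 br b β) := by
  simp only [lieBr_apply, cochainDiff_apply, map_add, map_neg, map_smul, LinearMap.smul_apply,
    lieDer_quadMap_preLie hbr hβ, lieDer_quadMap_preLie hbr hα]
  rcases sgn_parity (K := K) a with p | p <;> rcases sgn_parity (K := K) b with q | q <;>
    simp only [p, q, mul_add, add_mul, sgn_add, mul_one, one_mul] <;> module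

/-! ### Cochains -/

omit [DirectSum.Decomposition 𝒱] in
theorem wordDeg_ofFn {k : ℕ} (x : Fin k → Σ i, 𝒱 i) :
    wordDeg (List.ofFn x) = ∑ i, (x i).1 := by
  rw [wordDeg, List.map_ofFn, List.sum_ofFn]; rfl

-- The shift by 1 undoes s⁻¹, so that degrees of cochains become those of the suspended complex.
omit [DirectSum.Decomposition 𝒱] in
theorem mem_cochain_iff {n : ℤ} {α : SymAlg 𝒱 →ₗ[K] Module.End K V} :
    α ∈ cochain 𝒱 br n ↔ HasDegree (derDeg 𝒱 br) (n + 1) α := by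
  constructor
  · intro h l
    have := h (wordDeg l) (word 𝒱 l) (Submodule.subset_span ⟨l.length, fun i => (l.get i).1,
      fun i => (l.get i).2, fun i => (l.get i).2.2, ?_, ?_⟩)
    · rwa [← add_assoc]
    · rw [← wordDeg_ofFn, List.ofFn_get]
    · rw [← word_ofFn, List.ofFn_get]
  · intro h i x hx
    induction hx using Submodule.span_induction with
    | mem x hx =>
      obtain ⟨k, d, v, hv, rfl, rfl⟩ := hx
      have := h (List.ofFn fun i => ⟨d i, v i, hv i⟩)
      rwa [word_ofFn, wordDeg_ofFn, ← add_assoc] at this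
    | zero => rw [map_zero]; exact Submodule.zero_mem _
    | add x y _ _ hx hy => rw [map_add]; exact Submodule.add_mem _ hx hy
    | smul c x _ hx => rw [map_smul]; exact Submodule.smul_mem _ _ hx

end CochainLie

/-! ### Sums over shuffles -/

section InsertZero

/-- The permutation of `n + 1` letters with `i ↦ 0` which restricts to `σ` on the other letters. -/
def insertZero {n : ℕ} (i : Fin (n + 1)) (σ : Equiv.Perm (Fin n)) : Equiv.Perm (Fin (n + 1)) :=
  (finSuccEquiv' i).trans ((Equiv.optionCongr σ).trans (finSuccEquiv' 0).symm)

theorem insertZero_self {n : ℕ} (i : Fin (n + 1)) (σ : Equiv.Perm (Fin n)) :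
    insertZero i σ i = 0 := by
  simp [insertZero]

theorem insertZero_succAbove {n : ℕ} (i : Fin (n + 1)) (σ : Equiv.Perm (Fin n)) (j : Fin n) :
    insertZero i σ (i.succAbove j) = (σ j).succ := by
  simp [insertZero]

theorem sum_perm_succ {M : Type*} [AddCommMonoid M] {n : ℕ} (f : Equiv.Perm (Fin (n + 1)) → M) :
    ∑ σ, f σ = ∑ i, ∑ σ, f (insertZero i σ) := by
  have hinj : Function.Injective fun p : Fin (n + 1) × Equiv.Perm (Fin n) =>
      insertZero p.1 p.2 := by
    rintro ⟨i, σ⟩ ⟨j, τ⟩ h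
    dsimp only at h
    have hij : i = j := by
      apply (insertZero j τ).injective
      rw [insertZero_self, ← h, insertZero_self]
    subst hij
    refine Prod.ext rfl (Equiv.ext fun k => Fin.succ_injective _ ?_)
    rw [← insertZero_succAbove i, h, insertZero_succAbove]
  have hbij := (Fintype.bijective_iff_injective_and_card _).2 ⟨hinj, by
    simp [Fintype.card_perm, Nat.factorial_succ]⟩
  rw [← Fintype.sum_prod_type', ← hbij.sum_comp]

/-- The letter 0 is the smallest, so it is inverted with precisely the letters standing before
position `i`. -/
theorem koszulSign_insertZero {n : ℕ} (d : Fin (n + 1) → ℤ) (i : Fin (n + 1))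
    (σ : Equiv.Perm (Fin n)) :
    koszulSign d (insertZero i σ) =
      (d 0 * ∑ j ∈ (Finset.univ : Finset (Fin n)).filter (fun j : Fin n => (j : ℕ) < i),
        d (σ j).succ).negOnePow * koszulSign (fun j => d j.succ) σ := by
  have h : ∀ {m : ℕ} (e : Fin m → ℤ) (τ : Equiv.Perm (Fin m)), koszulSign e τ =
      ∏ a, ∏ b, if a < b ∧ τ b < τ a then (e (τ a) * e (τ b)).negOnePow else 1 := by
    intro m e τ
    rw [koszulSign, Finset.prod_filter, Fintype.prod_prod_type]
  have hsum : ∀ s : Finset (Fin n), (d 0 * ∑ j ∈ s, d (σ j).succ).negOnePow =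
      ∏ j ∈ s, (d (σ j).succ * d 0).negOnePow := by
    intro s
    induction s using Finset.cons_induction with
    | empty => simp
    | cons a s ha ih =>
      rw [Finset.sum_cons, Finset.prod_cons, mul_add, Int.negOnePow_add, ih, mul_comm (d 0)]
  have hcast : ∀ j : Fin n, ((j : ℕ) < i) = (j.castSucc < i) := fun j => rfl
  rw [h, h, Fin.prod_univ_succAbove _ i]
  simp only [Fin.prod_univ_succAbove _ i, insertZero_self, insertZero_succAbove, Fin.not_lt_zero,
    and_false, if_false, Finset.prod_const_one, one_mul, Fin.succ_pos, and_true,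
    Fin.succ_lt_succ_iff, Fin.succAbove_lt_succAbove_iff, Finset.prod_mul_distrib, hsum,
    Finset.prod_filter, Fin.succAbove_lt_iff_castSucc_lt, hcast]

/-- The permutations which are increasing on the first `a` letters and on the letters after the
first `b`. -/
def shuffleSet (n a b : ℕ) : Finset (Equiv.Perm (Fin n)) :=
  Finset.univ.filter fun σ => ∀ i j : Fin n, i < j → ((j : ℕ) < a ∨ b ≤ (i : ℕ)) → σ i < σ j

theorem mem_shuffleSet {n a b : ℕ} {σ : Equiv.Perm (Fin n)} : σ ∈ shuffleSet n a b ↔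
    ∀ i j : Fin n, i < j → ((j : ℕ) < a ∨ b ≤ (i : ℕ)) → σ i < σ j := by
  simp [shuffleSet]

theorem shuffles_pair {n a : ℕ} (h : a ≤ n) : shuffles n [a, n - a] = shuffleSet n a a := by
  ext σ
  rw [mem_shuffleSet, shuffles, Finset.mem_filter]
  constructor
  · rintro ⟨-, H⟩ i j hij (hj | hi)
    · exact H 0 (by simp) i j (by simp) hij (by simpa using hj)
    · exact H 1 (by simp) i j (by simpa using hi) hij (by simp; omega)
  · refine fun H => ⟨Finset.mem_univ _, fun c hc i j hi hij hj => ?_⟩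
    rw [List.length_cons, List.length_cons, List.length_nil] at hc
    interval_cases c
    · exact H i j hij (Or.inl (by simpa using hj))
    · exact H i j hij (Or.inr (by simpa using hi))

theorem shuffles_triple {n a : ℕ} (h : a < n) :
    shuffles n [a, 1, n - a - 1] = shuffleSet n a (a + 1) := by
  ext σ
  rw [mem_shuffleSet, shuffles, Finset.mem_filter]
  constructor
  · rintro ⟨-, H⟩ i j hij (hj | hi)
    · exact H 0 (by simp) i j (by simp) hij (by simpa using hj)
    · exact H 2 (by simp) i j (by simpa using hi) hij (by simp; omega)
  · refine fun H => ⟨Finset.mem_univ _, fun c hc i j hi hij hj => ?_⟩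
    rw [List.length_cons, List.length_cons, List.length_cons, List.length_nil] at hc
    interval_cases c
    · exact H i j hij (Or.inl (by simpa using hj))
    · simp at hi hj
      rw [Fin.lt_def] at hij
      omega
    · exact H i j hij (Or.inr (by simpa using hi))

/-- The smallest letter must open an increasing block or lie in the unconstrained middle; deleting
it shifts the block boundaries to its right. The truncated subtractions are harmless, since they
occur only when `i < a` or `i < b`. -/
theorem insertZero_mem_shuffleSet {n a b : ℕ} {i : Fin (n + 1)} {σ : Equiv.Perm (Fin n)} :
    insertZero i σ ∈ shuffleSet (n + 1) a b ↔ (i = 0 ∨ a ≤ (i : ℕ) ∧ (i : ℕ) ≤ b) ∧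
      σ ∈ shuffleSet n (if (i : ℕ) < a then a - 1 else a) (if (i : ℕ) < b then b - 1 else b) := by
  have hval : ∀ j : Fin n, (i.succAbove j : ℕ) = if (j : ℕ) < i then (j : ℕ) else j + 1 := by
    intro j
    rw [Fin.succAbove]
    simp only [Fin.lt_def, Fin.val_castSucc]
    split_ifs <;> simp
  rw [mem_shuffleSet, mem_shuffleSet]
  constructor
  · intro H
    refine ⟨?_, fun j k hjk hc => ?_⟩
    · by_contra hi
      rw [not_or] at hi
      have hpos : 0 < (i : ℕ) := Nat.pos_of_ne_zero fun h => hi.1 (Fin.ext h)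
      have := H ⟨i - 1, by omega⟩ i (by rw [Fin.lt_def]; dsimp only; omega)
        (by dsimp only; omega)
      rw [insertZero_self] at this
      exact absurd this (Fin.not_lt_zero _)
    · have := H (i.succAbove j) (i.succAbove k) (by simpa using hjk) (by
        rw [hval, hval]
        rw [Fin.lt_def] at hjk
        split_ifs at hc ⊢ <;> omega)
      simpa [insertZero_succAbove] using this
  · rintro ⟨hi, H⟩ j k hjk hc
    rcases Fin.eq_self_or_eq_succAbove i k with rfl | ⟨k, rfl⟩
    · exfalso
      rw [Fin.lt_def] at hjk
      rcases hi with rfl | hi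
      · simp at hjk
      · omega
    · rcases Fin.eq_self_or_eq_succAbove i j with rfl | ⟨j, rfl⟩
      · rw [insertZero_self, insertZero_succAbove]
        exact Fin.succ_pos _
      · rw [insertZero_succAbove, insertZero_succAbove, Fin.succ_lt_succ_iff]
        rw [Fin.succAbove_lt_succAbove_iff] at hjk
        refine H j k hjk ?_
        rw [hval, hval] at hc
        rw [Fin.lt_def] at hjk
        split_ifs at hc ⊢ <;> omega

theorem sum_shuffleSet_succ {M : Type*} [AddCommMonoid M] (n a b : ℕ)
    (f : Equiv.Perm (Fin (n + 1)) → M) :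
    ∑ σ ∈ shuffleSet (n + 1) a b, f σ = ∑ i : Fin (n + 1),
      if i = 0 ∨ a ≤ (i : ℕ) ∧ (i : ℕ) ≤ b then
        ∑ σ ∈ shuffleSet n (if (i : ℕ) < a then a - 1 else a) (if (i : ℕ) < b then b - 1 else b),
          f (insertZero i σ)
      else 0 := by
  have hite : ∀ {m : ℕ} (S : Finset (Equiv.Perm (Fin m))) (g : Equiv.Perm (Fin m) → M),
      ∑ σ ∈ S, g σ = ∑ σ, if σ ∈ S then g σ else 0 := fun S g => by simp
  rw [hite, sum_perm_succ]
  refine Finset.sum_congr rfl fun i _ => ?_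
  simp only [insertZero_mem_shuffleSet]
  by_cases h : i = 0 ∨ a ≤ (i : ℕ) ∧ (i : ℕ) ≤ b
  · rw [if_pos h, hite (shuffleSet n _ _)]
    simp only [h, true_and]
  · simp only [h, false_and, if_false, Finset.sum_const_zero]

end InsertZero

/-! ### Shuffle sums as recursive sums over distributions of letters -/

section WordSums

variable {X W : Type*} [AddCommGroup W] (deg : X → ℤ)

/-- The sum of `± F(s, t)` over all ways to distribute the letters of a word among two words. -/
def splitSum : List X → (List X → List X → W) → W
  | [], F => F [] []
  | v :: w, F => splitSum w (fun s t => F (v :: s) t) +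
      splitSum w (fun s t => (deg v * (s.map deg).sum).negOnePow • F s (v :: t))

/-- The sum of `± F(s, m, t)` over all ways to distribute the letters of a word among a word, a
single letter, and another word. -/
def markedSum : List X → (List X → X → List X → W) → W
  | [], _ => 0
  | v :: w, F => markedSum w (fun s m t => F (v :: s) m t) +
      splitSum deg w (fun s t => (deg v * (s.map deg).sum).negOnePow • F s v t) +
      markedSum w (fun s m t => (deg v * ((s.map deg).sum + deg m)).negOnePow • F s m (v :: t))

theorem ofFn_insertZero {n : ℕ} (x : Fin (n + 1) → X) (i : Fin (n + 1)) (σ : Equiv.Perm (Fin n)) :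
    List.ofFn (fun j => x (insertZero i σ j)) =
      (List.ofFn fun j => x (σ j).succ).take i ++ x 0 :: (List.ofFn fun j => x (σ j).succ).drop i := by
  refine List.ext_getElem (by simp; omega) fun m h1 h2 => ?_
  rw [List.length_ofFn] at h1
  rw [List.getElem_ofFn]
  rcases lt_trichotomy m i with h | h | h
  · rw [List.getElem_append_left (by simp; omega), List.getElem_take, List.getElem_ofFn,
      ← insertZero_succAbove i]
    congr 2
    rw [Fin.succAbove_of_castSucc_lt _ _ h]
    rfl
  · have : (⟨m, h1⟩ : Fin (n + 1)) = i := Fin.ext h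
    rw [this, insertZero_self, List.getElem_append_right (by simp; omega), List.getElem_cons,
      dif_pos (by simp; omega)]
  · obtain ⟨k, rfl⟩ := Nat.exists_eq_add_of_lt h
    rw [List.getElem_append_right (by simp; omega), List.getElem_cons, dif_neg (by simp; omega),
      List.getElem_drop, List.getElem_ofFn, ← insertZero_succAbove i]
    congr 2
    rw [Fin.succAbove_of_le_castSucc]
    · refine Fin.ext ?_
      simp only [List.length_take, List.length_ofFn, Fin.val_succ]
      omega
    · rw [Fin.le_def]
      simp only [List.length_take, List.length_ofFn, Fin.val_castSucc]
      omega

theorem sum_take_map_ofFn {n : ℕ} (y : Fin n → X) (a : ℕ) :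
    (((List.ofFn y).take a).map deg).sum =
      ∑ j ∈ (Finset.univ : Finset (Fin n)).filter (fun j : Fin n => (j : ℕ) < a), deg (y j) := by
  rw [List.map_take, List.map_ofFn, List.sum_take_ofFn]
  rfl

theorem koszulSign_insertZero_deg {n : ℕ} (x : Fin (n + 1) → X) (i : Fin (n + 1))
    (σ : Equiv.Perm (Fin n)) :
    koszulSign (fun j => deg (x j)) (insertZero i σ) =
      koszulSign (fun j => deg (x j.succ)) σ *
        (deg (x 0) * (((List.ofFn fun j => x (σ j).succ).take i).map deg).sum).negOnePow := by
  rw [koszulSign_insertZero, sum_take_map_ofFn, mul_comm]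

/-- In a shuffle the first letter stands at position 0 or opens the second block; these are the two
terms of the recursion. -/
theorem sum_shuffleSet_pair {n : ℕ} (x : Fin n → X) (F : List X → List X → W) :
    ∑ a : Fin (n + 1), ∑ σ ∈ shuffleSet n a a, koszulSign (fun j => deg (x j)) σ •
      F ((List.ofFn fun j => x (σ j)).take a) ((List.ofFn fun j => x (σ j)).drop a) =
    splitSum deg (List.ofFn x) F := by
  induction n generalizing F with
  | zero =>
    have : shuffleSet 0 0 0 = {1} := by
      ext σ; simp [mem_shuffleSet, Subsingleton.elim σ 1]
    simp [this, koszulSign_one, splitSum]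
  | succ n ih =>
    rw [List.ofFn_succ, splitSum, ← ih, ← ih]
    simp only [sum_shuffleSet_succ]
    -- For `a = 0` the two positions coincide; the condition `a ≠ 0` counts that case once, as a
    -- letter of the second block.
    have hsplit : ∀ (a : Fin (n + 2)) (i : Fin (n + 1)) (Z : W),
        (if i = 0 ∨ (a : ℕ) ≤ i ∧ (i : ℕ) ≤ a then Z else 0) =
          (if i = 0 then (if a ≠ 0 then Z else 0) else 0) +
            if a = i.castSucc then Z else 0 := by
      intro a i Z
      have e1 : (i = 0) ↔ (i : ℕ) = 0 := Fin.ext_iff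
      have e2 : (a = 0) ↔ (a : ℕ) = 0 := Fin.ext_iff
      have e3 : a = i.castSucc ↔ (a : ℕ) = i := Fin.ext_iff
      simp only [e1, e2, e3, ne_eq]
      split_ifs <;> first | omega | simp
    simp only [hsplit, Finset.sum_add_distrib]
    congr 1
    · simp only [Finset.sum_ite_eq', Finset.mem_univ, if_true]
      rw [Fin.sum_univ_succ]
      simp only [ne_eq, not_true_eq_false, if_false, zero_add, Fin.succ_ne_zero, not_false_eq_true,
        if_true, Fin.val_succ, Fin.val_zero, Nat.zero_lt_succ, Nat.add_sub_cancel]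
      refine Finset.sum_congr rfl fun a _ => Finset.sum_congr rfl fun σ _ => ?_
      rw [koszulSign_insertZero_deg, ofFn_insertZero]
      simp
    · rw [Finset.sum_comm]
      simp only [Finset.sum_ite_eq', Finset.mem_univ, if_true, Fin.val_castSucc, lt_irrefl,
        if_false]
      refine Finset.sum_congr rfl fun a _ => Finset.sum_congr rfl fun σ _ => ?_
      have hlen : ((List.ofFn fun j => x (σ j).succ).take a).length = a := by
        simp; omega
      rw [koszulSign_insertZero_deg, ofFn_insertZero, List.take_left' hlen, List.drop_left' hlen,
        mul_smul]

theorem sum_shuffleSet_triple {n : ℕ} (x : Fin n → X) (F : List X → X → List X → W) :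
    ∑ a : Fin n, ∑ σ ∈ shuffleSet n a (a + 1), koszulSign (fun j => deg (x j)) σ •
      F ((List.ofFn fun j => x (σ j)).take a) (x (σ a))
        ((List.ofFn fun j => x (σ j)).drop (a + 1)) =
    markedSum deg (List.ofFn x) F := by
  induction n generalizing F with
  | zero => simp [markedSum]
  | succ n ih =>
    rw [List.ofFn_succ, markedSum, ← ih, ← ih, ← sum_shuffleSet_pair]
    simp only [sum_shuffleSet_succ]
    -- The three summands correspond to the first letter lying in the first block, being the marked
    -- letter, and opening the last block.
    have hsplit : ∀ (a i : Fin (n + 1)) (Z : W),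
        (if i = 0 ∨ (a : ℕ) ≤ i ∧ (i : ℕ) ≤ a + 1 then Z else 0) =
          (if i = 0 then (if a ≠ 0 then Z else 0) else 0) + (if a = i then Z else 0) +
            if (i : ℕ) = a + 1 then Z else 0 := by
      intro a i Z
      have e1 : (i = 0) ↔ (i : ℕ) = 0 := Fin.ext_iff
      have e2 : (a = 0) ↔ (a : ℕ) = 0 := Fin.ext_iff
      have e3 : a = i ↔ (a : ℕ) = i := Fin.ext_iff
      simp only [e1, e2, e3, ne_eq]
      split_ifs <;> first | omega | simp
    simp only [hsplit, Finset.sum_add_distrib]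
    congr 1
    · congr 1
      · simp only [Finset.sum_ite_eq', Finset.mem_univ, if_true]
        rw [Fin.sum_univ_succ]
        simp only [ne_eq, not_true_eq_false, if_false, zero_add, Fin.succ_ne_zero,
          not_false_eq_true, if_true, Fin.val_succ, Fin.val_zero, Nat.zero_lt_succ,
          Nat.add_sub_cancel]
        refine Finset.sum_congr rfl fun a _ => Finset.sum_congr rfl fun σ _ => ?_
        rw [koszulSign_insertZero_deg, ofFn_insertZero, ← Fin.succAbove_zero,
          insertZero_succAbove]
        simp
      · rw [Finset.sum_comm]
        simp only [Finset.sum_ite_eq', Finset.mem_univ, if_true, lt_irrefl, if_false,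
          Nat.lt_succ_self, Nat.add_sub_cancel]
        refine Finset.sum_congr rfl fun a _ => Finset.sum_congr rfl fun σ _ => ?_
        have hlen : ((List.ofFn fun j => x (σ j).succ).take a).length = a := by
          simp; omega
        rw [koszulSign_insertZero_deg, ofFn_insertZero, List.take_left' hlen, insertZero_self,
          ← List.drop_drop, List.drop_left' hlen, List.drop_one, List.tail_cons, mul_smul]
    -- When the marked position is the last one, the third block is empty and no letter can open it,
    -- so this summand drops out.
    · rw [Fin.sum_univ_castSucc]
      have hlast : ∀ i : Fin (n + 1), ¬ ((i : ℕ) = ((Fin.last n : Fin (n + 1)) : ℕ) + 1) := by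
        intro i; simp; omega
      have hsucc : ∀ (a : Fin n) (i : Fin (n + 1)),
          ((i : ℕ) = (a : ℕ) + 1) = (i = a.succ) := by
        intro a i; simp [Fin.ext_iff]
      simp only [hlast, if_false, Finset.sum_const_zero, add_zero, hsucc, Finset.sum_ite_eq',
        Finset.mem_univ, if_true, Fin.val_castSucc, Fin.val_succ, lt_irrefl]
      refine Finset.sum_congr rfl fun a _ => ?_
      rw [if_neg (by omega)]
      refine Finset.sum_congr rfl fun σ _ => ?_
      have hlen : ((List.ofFn fun j => x (σ j).succ).take (a + 1)).length = a + 1 := by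
        simp
      have hcs : a.castSucc = (a.succ).succAbove a := by
        rw [Fin.succAbove_of_castSucc_lt _ _ (Fin.castSucc_lt_succ)]
      have hsum : (((List.ofFn fun j => x (σ j).succ).take (a + 1)).map deg).sum =
          (((List.ofFn fun j => x (σ j).succ).take a).map deg).sum + deg (x (σ a).succ) := by
        rw [List.take_succ_eq_append_getElem (by simp), List.map_append, List.sum_append]
        simp
      have htake : (List.take (a + 1) (List.ofFn fun j => x (σ j).succ) ++
          x 0 :: List.drop (a + 1) (List.ofFn fun j => x (σ j).succ)).take a =
          (List.ofFn fun j => x (σ j).succ).take a := by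
        rw [List.take_append_of_le_length (by omega), List.take_take]
        congr 1
        omega
      rw [koszulSign_insertZero_deg, ofFn_insertZero, Fin.val_succ, hsum, List.drop_left' hlen,
        htake, hcs, insertZero_succAbove, mul_smul]

/-- Exchanging the two parts of every splitting puts both halves of a graded commutator over the
same splittings. -/
theorem splitSum_swap (l : List X) (F : List X → List X → W) :
    splitSum deg l F = splitSum deg l
      (fun s t => ((s.map deg).sum * (t.map deg).sum).negOnePow • F t s) := by
  induction l generalizing F with
  | nil => simp [splitSum]
  | cons v w ih =>
    rw [splitSum, splitSum, add_comm]
    congr 1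
    · rw [ih]
      congr 1
      funext s t
      rw [smul_smul, ← Int.negOnePow_add, List.map_cons, List.sum_cons]
      congr 2
      ring
    · rw [ih]
      congr 1
      funext s t
      rw [smul_smul, ← Int.negOnePow_add, List.map_cons, List.sum_cons,
        show deg v * (s.map deg).sum + (s.map deg).sum * (deg v + (t.map deg).sum) =
          2 * (deg v * (s.map deg).sum) + (s.map deg).sum * (t.map deg).sum by ring,
        Int.negOnePow_add, Int.negOnePow_two_mul, one_mul]

theorem splitSum_map {W' : Type*} [AddCommGroup W'] (f : W →+ W') (l : List X)
    (F : List X → List X → W) :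
    f (splitSum deg l F) = splitSum deg l (fun s t => f (F s t)) := by
  induction l generalizing F with
  | nil => rfl
  | cons v w ih => simp only [splitSum, map_add, ih, Units.smul_def, map_zsmul]

theorem smul_splitSum (u : ℤˣ) (l : List X) (F : List X → List X → W) :
    u • splitSum deg l F = splitSum deg l (fun s t => u • F s t) :=
  splitSum_map deg (DistribSMul.toAddMonoidHom W u) l F

theorem smul_markedSum (u : ℤˣ) (l : List X) (F : List X → X → List X → W) :
    u • markedSum deg l F = markedSum deg l (fun s m t => u • F s m t) := by
  induction l generalizing F with
  | nil => simp [markedSum]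
  | cons v w ih => simp only [markedSum, smul_add, ih, smul_splitSum, smul_comm u]

/-- The sum of `± F(m, t)` over all ways to remove a letter `m` from a word, where `t` is the rest
of the word. -/
def pickSum : List X → (X → List X → W) → W
  | [], _ => 0
  | v :: w, F => F v w + pickSum w (fun m t => (deg v * deg m).negOnePow • F m (v :: t))

/-- The sum of `± F(u, m, t)` over all ways to remove two letters `u, m` from a word, where `t` is
the rest of the word. -/
def pairSum : List X → (X → X → List X → W) → W
  | [], _ => 0
  | v :: w, F => pickSum deg w (F v) +
      pairSum w (fun u m t => (deg v * (deg u + deg m)).negOnePow • F u m (v :: t))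

theorem smul_pickSum (u : ℤˣ) (l : List X) (F : X → List X → W) :
    u • pickSum deg l F = pickSum deg l (fun m t => u • F m t) := by
  induction l generalizing F with
  | nil => simp [pickSum]
  | cons v w ih => simp only [pickSum, smul_add, ih, smul_comm u]

theorem smul_pairSum (u : ℤˣ) (l : List X) (F : X → X → List X → W) :
    u • pairSum deg l F = pairSum deg l (fun x y t => u • F x y t) := by
  induction l generalizing F with
  | nil => simp [pairSum]
  | cons v w ih => simp only [pairSum, smul_add, ih, smul_pickSum, smul_comm u]

theorem sum_Iio_succ {M : Type*} [AddCommMonoid M] {n : ℕ} (f : Fin (n + 1) → M) (i : Fin n) :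
    ∑ a ∈ Finset.Iio i.succ, f a = f 0 + ∑ a ∈ Finset.Iio i, f a.succ := by
  have h : ∀ {m : ℕ} (j : Fin m) (g : Fin m → M),
      ∑ a ∈ Finset.Iio j, g a = ∑ a, if a < j then g a else 0 := by
    intro m j g
    rw [← Finset.sum_filter]
    congr 1
    ext
    simp
  rw [h, h, Fin.sum_univ_succ]
  simp

theorem pickSum_ofFn {n : ℕ} (x : Fin n → X) (F : X → List X → W) :
    pickSum deg (List.ofFn x) F = ∑ j : Fin n,
      (deg (x j) * ∑ a ∈ Finset.Iio j, deg (x a)).negOnePow •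
        F (x j) ((List.ofFn x).eraseIdx j) := by
  induction n generalizing F with
  | zero => simp [pickSum]
  | succ n ih =>
    rw [List.ofFn_succ, pickSum, ih, Fin.sum_univ_succ]
    congr 1
    · have : Finset.Iio (0 : Fin (n + 1)) = ∅ := by ext; simp
      simp [this]
    · refine Finset.sum_congr rfl fun j _ => ?_
      rw [smul_smul, ← Int.negOnePow_add, sum_Iio_succ, Fin.val_succ, List.eraseIdx_cons_succ]
      congr 2
      ring

/-- The prefix sum before `j` still counts the letter `i`, which has already been taken out; the
term `deg (x i) * deg (x j)` compensates. Erasing `j` first leaves the index `i < j` valid. -/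
theorem pairSum_ofFn {n : ℕ} (x : Fin n → X) (F : X → X → List X → W) :
    pairSum deg (List.ofFn x) F = ∑ i : Fin n, ∑ j ∈ Finset.Ioi i,
      (deg (x i) * (∑ a ∈ Finset.Iio i, deg (x a)) + deg (x j) * (∑ a ∈ Finset.Iio j, deg (x a)) +
        deg (x i) * deg (x j)).negOnePow •
        F (x i) (x j) (((List.ofFn x).eraseIdx j).eraseIdx i) := by
  have hIoi : ∀ {m : ℕ} (j : Fin m) (g : Fin m → W),
      ∑ a ∈ Finset.Ioi j, g a = ∑ a, if j < a then g a else 0 := by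
    intro m j g
    rw [← Finset.sum_filter]
    congr 1
    ext
    simp
  induction n generalizing F with
  | zero => simp [pairSum]
  | succ n ih =>
    rw [List.ofFn_succ, pairSum, ih, pickSum_ofFn, Fin.sum_univ_succ]
    congr 1
    · have : Finset.Iio (0 : Fin (n + 1)) = ∅ := by ext; simp
      rw [hIoi, Fin.sum_univ_succ, if_neg (lt_irrefl _), zero_add, this]
      refine Finset.sum_congr rfl fun j _ => ?_
      rw [if_pos (Fin.succ_pos j), sum_Iio_succ, Fin.val_succ, List.eraseIdx_cons_succ,
        Fin.val_zero, List.eraseIdx_zero, List.tail_cons, Finset.sum_empty,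
        show deg (x 0) * 0 + deg (x j.succ) * (deg (x 0) + ∑ a ∈ Finset.Iio j, deg (x a.succ)) +
          deg (x 0) * deg (x j.succ) = 2 * (deg (x 0) * deg (x j.succ)) +
            deg (x j.succ) * ∑ a ∈ Finset.Iio j, deg (x a.succ) by ring,
        Int.negOnePow_add, Int.negOnePow_two_mul, one_mul]
    · refine Finset.sum_congr rfl fun i _ => ?_
      rw [hIoi, hIoi, Fin.sum_univ_succ, if_neg (Fin.not_lt_zero _), zero_add]
      refine Finset.sum_congr rfl fun j _ => ?_
      simp only [Fin.succ_lt_succ_iff]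
      split_ifs with h
      · rw [smul_smul, ← Int.negOnePow_add, sum_Iio_succ, sum_Iio_succ, Fin.val_succ, Fin.val_succ,
          List.eraseIdx_cons_succ, List.eraseIdx_cons_succ]
        congr 2
        ring
      · rfl

end WordSums

/-! ### Explicit values of products and Lie derivatives on words -/

section Formulas

variable {K V : Type*} [Field K] [AddCommGroup V] [Module K V] {𝒱 : ℤ → Submodule K V}
  [DirectSum.Decomposition 𝒱] {br : V →ₗ[K] V →ₗ[K] V}
  {W W₁ W₂ W₃ : Type*} [AddCommGroup W] [Module K W] [AddCommGroup W₁] [Module K W₁]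
  [AddCommGroup W₂] [Module K W₂] [AddCommGroup W₃] [Module K W₃]

variable (𝒱) in
/-- The underlying list of vectors of a word. -/
def vals (l : List (Σ i, 𝒱 i)) : List V := l.map fun h => (h.2 : V)

omit [DirectSum.Decomposition 𝒱] in
theorem symList_cons_vals {c : ℤ} {v : V} (hv : v ∈ 𝒱 c) (t : List (Σ i, 𝒱 i)) :
    symList 𝒱 (v :: vals 𝒱 t) = word 𝒱 (⟨c, v, hv⟩ :: t) := rfl

omit [DirectSum.Decomposition 𝒱] in
theorem map_symList_smul_cons (α : SymAlg 𝒱 →ₗ[K] W) (a : K) (v : V) (t : List V) :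
    α (symList 𝒱 (a • v :: t)) = a • α (symList 𝒱 (v :: t)) := by
  have h := symList_append_cons_smul 𝒱 [] t a v
  rw [List.nil_append, List.nil_append] at h
  rw [h, map_smul]

theorem map_symList_cons_cons (α : SymAlg 𝒱 →ₗ[K] W) {c : ℤ} {v : V} (hv : v ∈ 𝒱 c)
    (h : Σ i, 𝒱 i) (t : List (Σ i, 𝒱 i)) :
    α (symList 𝒱 (v :: vals 𝒱 (h :: t))) =
      sgn K (h.1 * c) • contract W h α (symList 𝒱 (v :: vals 𝒱 t)) := by
  have h1 := DFunLike.congr_fun (contract_contract_sgn ⟨c, v, hv⟩ h α) (word 𝒱 t)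
  rw [LinearMap.smul_apply, contract_word, contract_word, contract_word] at h1
  rw [symList_cons_vals hv, symList_cons_vals hv, h1, mul_comm]

theorem prodMap_word (μ : W₁ →ₗ[K] W₂ →ₗ[K] W₃) (b : ℤ) (α : SymAlg 𝒱 →ₗ[K] W₁)
    (β : SymAlg 𝒱 →ₗ[K] W₂) (l : List (Σ i, 𝒱 i)) :
    prodMap μ b α β (word 𝒱 l) = splitSum Sigma.fst l
      (fun s t => (b * wordDeg s).negOnePow • μ (α (word 𝒱 s)) (β (word 𝒱 t))) := by
  induction l generalizing b α β with
  | nil => simp [splitSum, prodMap_nil, wordDeg_nil]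
  | cons h l ih =>
    rw [← contract_word, contract_prodMap, LinearMap.add_apply, LinearMap.smul_apply, ih, ih,
      splitSum, add_comm]
    congr 1
    · rw [← negOnePow_smul (K := K), smul_splitSum]
      congr 1
      funext s t
      rw [contract_word, smul_smul, ← Int.negOnePow_add, wordDeg_cons]
      congr 2
      ring
    · congr 1
      funext s t
      rw [contract_word, smul_smul, ← Int.negOnePow_add, ← wordDeg]
      congr 2
      ring

theorem lieDer_word {c : ℤ} {X : SymAlg 𝒱 →ₗ[K] V} (hX : HasDegree 𝒱 c X)
    (α : SymAlg 𝒱 →ₗ[K] W) (l : List (Σ i, 𝒱 i)) :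
    lieDer W c X α (word 𝒱 l) = splitSum Sigma.fst l
      (fun s t => α (symList 𝒱 (X (word 𝒱 s) :: vals 𝒱 t))) := by
  induction l generalizing c X α with
  | nil => rw [lieDer_nil]; rfl
  | cons h l ih =>
    rw [← contract_word, contract_lieDer, LinearMap.add_apply, LinearMap.smul_apply,
      ih (hX.contract h), ih hX, splitSum]
    congr 1
    · simp only [contract_word]
    · rw [← negOnePow_smul (K := K), smul_splitSum]
      congr 1
      funext s t
      rw [negOnePow_smul (K := K), map_symList_cons_cons α (hX s),
        negOnePow_smul (K := K), smul_smul, ← wordDeg, mul_add, sgn_add, ← mul_assoc,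
        sgn_mul_self, one_mul]

theorem prodMap_const (μ : W₁ →ₗ[K] W₂ →ₗ[K] W₃) (b : ℤ) (α : SymAlg 𝒱 →ₗ[K] W₁)
    (β : SymAlg 𝒱 →ₗ[K] W₂) (hβ : ∀ h, contract W₂ h β = 0) (l : List (Σ i, 𝒱 i)) :
    prodMap μ b α β (word 𝒱 l) =
      sgn K (b * wordDeg l) • μ (α (word 𝒱 l)) (β (word 𝒱 [])) := by
  induction l generalizing α with
  | nil => rw [prodMap_nil, wordDeg_nil, mul_zero, sgn_zero, one_smul]
  | cons h l ih =>
    rw [← contract_word, contract_prodMap, hβ, map_zero, zero_add, LinearMap.smul_apply, ih,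
      contract_word, smul_smul, ← sgn_add, wordDeg_cons]
    congr 2
    ring

theorem lieDer_const {c : ℤ} {X : SymAlg 𝒱 →ₗ[K] V} (hX : HasDegree 𝒱 c X)
    (hc : ∀ h, contract V h X = 0) (α : SymAlg 𝒱 →ₗ[K] W) (l : List (Σ i, 𝒱 i)) :
    lieDer W c X α (word 𝒱 l) = α (symList 𝒱 (X (word 𝒱 []) :: vals 𝒱 l)) := by
  induction l generalizing α with
  | nil => rw [lieDer_nil]; rfl
  | cons h l ih =>
    rw [← contract_word, contract_lieDer, hc, map_zero, LinearMap.zero_apply, zero_add,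
      LinearMap.smul_apply, ih, map_symList_cons_cons α hX.nil]

/-- The next letter is fed to β, becomes the vector to which β is applied, or stays with α: the
three terms of `markedSum`. -/
theorem lieDer_vfMap_word {b : ℤ} {β : SymAlg 𝒱 →ₗ[K] Module.End K V}
    (hβ : HasDegree (derDeg 𝒱 br) b β) (α : SymAlg 𝒱 →ₗ[K] W) (l : List (Σ i, 𝒱 i)) :
    lieDer W b (vfMap 𝒱 β) α (word 𝒱 l) = markedSum Sigma.fst l
      (fun s m t => α (symList 𝒱 (β (word 𝒱 s) (m.2 : V) :: vals 𝒱 t))) := by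
  induction l generalizing b β α with
  | nil =>
    rw [lieDer_nil, vfMap_apply, prodMap_nil, projMap_nil, map_zero, map_zero, map_zero]
    rfl
  | cons h l ih =>
    have e : contract V h (vfMap 𝒱 β) =
        prodMap (evalMap K V) h.1 β (contract V h (projMap 𝒱)) +
          vfMap 𝒱 (contract _ h β) := by
      rw [vfMap_apply, contract_prodMap, mul_zero, sgn_zero, one_smul, zero_add]
      rfl
    have hY : HasDegree 𝒱 (b + h.1)
        (prodMap (evalMap K V) h.1 β (contract V h (projMap 𝒱))) := by
      have := hβ.prodMap (μ := evalMap K V) (k := 0)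
        (fun a b f hf x hx => by rw [add_zero, add_comm]; exact hf.1 b x hx)
        ((hasDegree_projMap (𝒱 := 𝒱)).contract h)
      rwa [add_zero, zero_add] at this
    rw [← contract_word, contract_lieDer, e, map_add, LinearMap.add_apply, LinearMap.add_apply,
      LinearMap.add_apply, LinearMap.smul_apply, ih (hβ.contract h), ih hβ, lieDer_word hY,
      markedSum, add_comm (splitSum _ _ _)]
    congr 1
    · congr 1
      · simp only [contract_word]
      · congr 1
        funext s t
        -- The derivative of x ↦ x along `h` is the constant `h`, so all letters in the insertion go
        -- to β, with the sign of moving `h` past them.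
        rw [prodMap_const _ _ _ _ (fun g => contract_contract_projMap h g), contract_word,
          projMap_singleton, negOnePow_smul (K := K), map_symList_smul_cons]
        rfl
    · rw [← negOnePow_smul (K := K), smul_markedSum]
      congr 1
      funext s m t
      rw [map_symList_cons_cons α ((hβ s).1 _ _ m.2.2), negOnePow_smul (K := K),
        negOnePow_smul (K := K), smul_smul, ← sgn_add, ← wordDeg]
      congr 1
      rcases sgn_parity (K := K) h.1 with p | p <;>
        rcases sgn_parity (K := K) m.1 with q | q <;>
        simp [p, q, mul_add, sgn_add, ← mul_assoc, sgn_mul_self]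

/-- Both orders of differentiating ½[x,x] contribute the same bracket, which absorbs the ½; the
result is constant. -/
theorem contract_contract_quadMap [CharZero K] (hbr : IsSymGradedLie 𝒱 br) (g h : Σ i, 𝒱 i) :
    contract V h (contract V g (quadMap 𝒱 br)) (word 𝒱 []) = br g.2 h.2 ∧
      ∀ k, contract V k (contract V h (contract V g (quadMap 𝒱 br))) = 0 := by
  simp only [quadMap, map_smul, contract_prodMap, map_add, contract_contract_projMap, map_zero,
    LinearMap.zero_apply, smul_zero, add_zero, zero_add, mul_zero, sgn_zero, one_smul,
    LinearMap.smul_apply, LinearMap.add_apply, prodMap_nil, contract_word, projMap_singleton,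
    implies_true, and_true]
  rw [hbr.symm _ _ _ _ h.2.2 g.2.2, negOnePow_smul (K := K), smul_smul, sgn_mul_self, one_smul,
    ← two_smul K, smul_smul, inv_mul_cancel₀ two_ne_zero, one_smul]

/-- As Q is homogeneous quadratic, exactly two letters enter it; `hpick` treats the stage at which
the first has been chosen. -/
theorem lieDer_quadMap_word [CharZero K] (hbr : IsSymGradedLie 𝒱 br) (β : SymAlg 𝒱 →ₗ[K] W)
    (l : List (Σ i, 𝒱 i)) :
    lieDer W 1 (quadMap 𝒱 br) β (word 𝒱 l) = pairSum Sigma.fst l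
      (fun g h t => β (symList 𝒱 (br g.2 h.2 :: vals 𝒱 t))) := by
  have hQ := hasDegree_quadMap hbr
  have hpick : ∀ (g : Σ i, 𝒱 i) (l : List (Σ i, 𝒱 i)) (β : SymAlg 𝒱 →ₗ[K] W),
      lieDer W (1 + g.1) (contract V g (quadMap 𝒱 br)) β (word 𝒱 l) = pickSum Sigma.fst l
        (fun h t => β (symList 𝒱 (br g.2 h.2 :: vals 𝒱 t))) := by
    intro g l β
    induction l generalizing β with
    | nil =>
      have h0 : contract V g (quadMap 𝒱 br) (word 𝒱 []) = 0 := by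
        rw [quadMap, map_smul, contract_prodMap, LinearMap.smul_apply, LinearMap.add_apply,
          LinearMap.smul_apply, prodMap_nil, prodMap_nil, projMap_nil, map_zero,
          LinearMap.zero_apply, map_zero, smul_zero, add_zero, smul_zero]
      rw [lieDer_nil, h0, map_zero, map_zero]
      rfl
    | cons h l ih =>
      rw [← contract_word, contract_lieDer, LinearMap.add_apply, LinearMap.smul_apply, ih,
        lieDer_const ((hQ.contract g).contract h) (contract_contract_quadMap hbr g h).2,
        (contract_contract_quadMap hbr g h).1, pickSum, ← negOnePow_smul (K := K)]
      rw [smul_pickSum]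
      congr 2
      funext m t
      rw [map_symList_cons_cons β (hbr.degree _ _ _ _ g.2.2 m.2.2), negOnePow_smul (K := K),
        negOnePow_smul (K := K), smul_smul, ← sgn_add]
      congr 1
      rcases sgn_parity (K := K) g.1 with p | p <;>
        rcases sgn_parity (K := K) h.1 with q | q <;> rcases sgn_parity (K := K) m.1 with r | r <;>
        simp [p, q, r, mul_add, sgn_add]
  induction l generalizing β with
  | nil =>
    have h0 : quadMap 𝒱 br (word 𝒱 []) = 0 := by
      rw [quadMap, LinearMap.smul_apply, prodMap_nil, projMap_nil, map_zero, smul_zero]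
    rw [lieDer_nil, h0, map_zero, map_zero]
    rfl
  | cons g l ih =>
    rw [← contract_word, contract_lieDer, LinearMap.add_apply, LinearMap.smul_apply, ih, hpick,
      pairSum, mul_one, ← negOnePow_smul (K := K), smul_pairSum]
    congr 2
    funext u m t
    rw [map_symList_cons_cons β (hbr.degree _ _ _ _ u.2.2 m.2.2), negOnePow_smul (K := K),
      negOnePow_smul (K := K), smul_smul, ← sgn_add]
    congr 1
    rcases sgn_parity (K := K) g.1 with p | p <;>
      rcases sgn_parity (K := K) u.1 with q | q <;> rcases sgn_parity (K := K) m.1 with r | r <;>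
      simp [p, q, r, mul_add, sgn_add]

end Formulas

/-! ### The differential graded Lie algebra given by the shuffle formulas -/

section Assembly

variable {K V : Type*} [Field K] [AddCommGroup V] [Module K V] {𝒱 : ℤ → Submodule K V}
  {br : V →ₗ[K] V →ₗ[K] V}

theorem vals_ofFn {p : ℕ} (x : Fin p → Σ i, 𝒱 i) :
    vals 𝒱 (List.ofFn x) = List.ofFn fun i => ((x i).2 : V) := by
  rw [vals, List.map_ofFn]; rfl

theorem symList_take_ofFn {p : ℕ} (x : Fin p → Σ i, 𝒱 i) (a : ℕ) :
    symList 𝒱 ((List.ofFn fun i => ((x i).2 : V)).take a) = word 𝒱 ((List.ofFn x).take a) := by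
  rw [word, List.map_take, ← vals_ofFn]; rfl

theorem symList_drop_ofFn {p : ℕ} (x : Fin p → Σ i, 𝒱 i) (a : ℕ) :
    symList 𝒱 ((List.ofFn fun i => ((x i).2 : V)).drop a) = word 𝒱 ((List.ofFn x).drop a) := by
  rw [word, List.map_drop, ← vals_ofFn]; rfl

variable [DirectSum.Decomposition 𝒱]

theorem symAlg_ext_ofFn {W : Type*} [AddCommGroup W] [Module K W] {f g : SymAlg 𝒱 →ₗ[K] W}
    (h : ∀ (p : ℕ) (x : Fin p → Σ i, 𝒱 i), f (word 𝒱 (List.ofFn x)) = g (word 𝒱 (List.ofFn x))) :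
    f = g :=
  symAlg_ext fun l => by rw [← List.ofFn_get l]; exact h _ _

theorem cochainDiff_ofFn [CharZero K] (hbr : IsSymGradedLie 𝒱 br) (i : ℤ)
    (β : SymAlg 𝒱 →ₗ[K] Module.End K V) {p : ℕ} (x : Fin p → Σ i, 𝒱 i) :
    cochainDiff 𝒱 br i β (word 𝒱 (List.ofFn x)) =
      ∑ a : Fin p, ∑ b ∈ Finset.Ioi a,
        (i + (x a).1 * (∑ c ∈ Finset.Iio a, (x c).1) + (x b).1 * (∑ c ∈ Finset.Iio b, (x c).1)
          + (x a).1 * (x b).1).negOnePow •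
        β (symList 𝒱 (br (x a).2 (x b).2 ::
          ((List.ofFn fun c => ((x c).2 : V)).eraseIdx b).eraseIdx a)) := by
  rw [cochainDiff_apply, LinearMap.smul_apply, lieDer_quadMap_word hbr, pairSum_ofFn,
    Finset.smul_sum]
  refine Finset.sum_congr rfl fun a _ => ?_
  rw [Finset.smul_sum]
  refine Finset.sum_congr rfl fun b _ => ?_
  rw [← negOnePow_smul (K := K), smul_smul, ← Int.negOnePow_add, vals, ← List.eraseIdx_map,
    ← List.eraseIdx_map, ← vals, vals_ofFn, add_assoc, add_assoc, add_assoc]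

theorem isCochainDiff_iff [CharZero K] (hbr : IsSymGradedLie 𝒱 br) {i : ℤ}
    {β γ : SymAlg 𝒱 →ₗ[K] Module.End K V} :
    IsCochainDiff 𝒱 br (i - 1) β γ ↔ γ = cochainDiff 𝒱 br i β := by
  constructor
  · intro h
    refine symAlg_ext_ofFn fun p x => ?_
    have h1 := h p (fun i => (x i).1) (fun i => ((x i).2 : V)) (fun i => (x i).2.2)
    rw [sub_add_cancel] at h1
    rw [cochainDiff_ofFn hbr, word_ofFn, h1]
  · rintro rfl p d v hv
    have h1 := cochainDiff_ofFn hbr i β (fun i => (⟨d i, v i, hv i⟩ : Σ i, 𝒱 i))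
    rw [sub_add_cancel]
    rwa [word_ofFn] at h1

theorem insertion_eq {b : ℤ} {α β : SymAlg 𝒱 →ₗ[K] Module.End K V}
    (hβ : HasDegree (derDeg 𝒱 br) b β) {p : ℕ} (x : Fin p → Σ i, 𝒱 i) :
    insertion 𝒱 α β (fun i => (x i).1) (fun i => ((x i).2 : V)) =
      lieDer _ b (vfMap 𝒱 β) α (word 𝒱 (List.ofFn x)) := by
  rw [lieDer_vfMap_word hβ, ← sum_shuffleSet_triple, insertion]
  refine Finset.sum_congr rfl fun l _ => ?_
  rw [shuffles_triple l.2]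
  refine Finset.sum_congr rfl fun σ _ => ?_
  rw [symList_take_ofFn fun i => x (σ i), vals, List.map_drop, ← vals,
    vals_ofFn fun i => x (σ i)]

omit [DirectSum.Decomposition 𝒱] in
theorem headDeg_eq {p : ℕ} (x : Fin p → Σ i, 𝒱 i) (σ : Equiv.Perm (Fin p)) (a : ℕ) :
    headDeg (fun i => (x i).1) σ a = wordDeg ((List.ofFn fun i => x (σ i)).take a) :=
  (sum_take_map_ofFn Sigma.fst (fun i => x (σ i)) a).symm

omit [DirectSum.Decomposition 𝒱] in
theorem tailDeg_eq {p : ℕ} (x : Fin p → Σ i, 𝒱 i) (σ : Equiv.Perm (Fin p)) (a : ℕ) :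
    tailDeg (fun i => (x i).1) σ a = wordDeg ((List.ofFn fun i => x (σ i)).drop a) := by
  have h1 : headDeg (fun i => (x i).1) σ a + tailDeg (fun i => (x i).1) σ a =
      wordDeg (List.ofFn fun i => x (σ i)) := by
    rw [wordDeg_ofFn, headDeg, tailDeg,
      ← Finset.sum_filter_add_sum_filter_not Finset.univ (fun i : Fin p => (i : ℕ) < a)]
    simp only [not_lt]
  have h2 : wordDeg (List.ofFn fun i => x (σ i)) =
      wordDeg ((List.ofFn fun i => x (σ i)).take a) +
        wordDeg ((List.ofFn fun i => x (σ i)).drop a) := by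
    rw [wordDeg, wordDeg, wordDeg, ← List.sum_append, ← List.map_append, List.take_append_drop]
  rw [headDeg_eq, h2] at h1
  exact add_left_cancel h1

omit [DirectSum.Decomposition 𝒱] in
theorem sum_shuffles_pair {W : Type*} [AddCommGroup W] {p : ℕ} (x : Fin p → Σ i, 𝒱 i)
    (F : List (Σ i, 𝒱 i) → List (Σ i, 𝒱 i) → W) :
    ∑ a ∈ Finset.range (p + 1), ∑ σ ∈ shuffles p [a, p - a],
      koszulSign (fun i => (x i).1) σ • F ((List.ofFn fun i => x (σ i)).take a)
        ((List.ofFn fun i => x (σ i)).drop a) = splitSum Sigma.fst (List.ofFn x) F := by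
  rw [← sum_shuffleSet_pair, Finset.sum_range]
  refine Finset.sum_congr rfl fun a _ => ?_
  rw [shuffles_pair (Nat.le_of_lt_succ a.2)]

theorem splitSum_gradedComm (a b : ℤ) (α β : SymAlg 𝒱 →ₗ[K] Module.End K V)
    (l : List (Σ i, 𝒱 i)) :
    splitSum Sigma.fst l (fun s t => (b * wordDeg s).negOnePow •
      gradedComm (a + wordDeg s) (b + wordDeg t) (α (word 𝒱 s)) (β (word 𝒱 t))) =
    (prodMap (LinearMap.mul K (Module.End K V)) b α β -
      sgn K (a * b) • prodMap (LinearMap.mul K (Module.End K V)) a β α) (word 𝒱 l) := by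
  have hadd : ∀ (l : List (Σ i, 𝒱 i)) (F G : List (Σ i, 𝒱 i) → List (Σ i, 𝒱 i) → Module.End K V),
      splitSum Sigma.fst l (fun s t => F s t - G s t) =
        splitSum Sigma.fst l F - splitSum Sigma.fst l G := by
    intro l
    induction l with
    | nil => intro F G; rfl
    | cons v w ih => intro F G; simp only [splitSum, ih, smul_sub]; abel
  rw [LinearMap.sub_apply, LinearMap.smul_apply, prodMap_word, prodMap_word,
    ← negOnePow_smul (K := K), smul_splitSum, splitSum_swap Sigma.fst l (fun s t => _ • _ • _),
    ← hadd]
  congr 1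
  funext s t
  rw [gradedComm, smul_sub, LinearMap.mul_apply', LinearMap.mul_apply', smul_smul, smul_smul,
    smul_smul, ← Int.negOnePow_add, ← Int.negOnePow_add, ← Int.negOnePow_add]
  congr 2
  -- After the swap the two exponents differ by twice b·|s|.
  rw [Int.negOnePow_eq_iff, ← wordDeg, ← wordDeg]
  exact ⟨b * wordDeg s, by ring⟩

theorem isCochainBracket_iff {a b : ℤ} {α β γ : SymAlg 𝒱 →ₗ[K] Module.End K V}
    (hα : HasDegree (derDeg 𝒱 br) a α) (hβ : HasDegree (derDeg 𝒱 br) b β) :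
    IsCochainBracket 𝒱 (a - 1) (b - 1) α β γ ↔ γ = lieBr 𝒱 a b α β := by
  have key : ∀ (p : ℕ) (x : Fin p → Σ i, 𝒱 i),
      lieBr 𝒱 a b α β (word 𝒱 (List.ofFn x)) =
      -insertion 𝒱 α β (fun i => (x i).1) (fun i => ((x i).2 : V))
      + (a * b).negOnePow • insertion 𝒱 β α (fun i => (x i).1) (fun i => ((x i).2 : V))
      - ∑ k ∈ Finset.range (p + 1), ∑ σ ∈ shuffles p [k, p - k],
          (b * headDeg (fun i => (x i).1) σ k).negOnePow • koszulSign (fun i => (x i).1) σ •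
            gradedComm (a + headDeg (fun i => (x i).1) σ k) (b + tailDeg (fun i => (x i).1) σ k)
              (α (symList 𝒱 ((List.ofFn (fun i => ((x (σ i)).2 : V))).take k)))
              (β (symList 𝒱 ((List.ofFn (fun i => ((x (σ i)).2 : V))).drop k))) := by
    intro p x
    have h := splitSum_gradedComm a b α β (List.ofFn x)
    rw [← sum_shuffles_pair] at h
    have ht := fun (σ : Equiv.Perm (Fin p)) k => symList_take_ofFn (fun i => x (σ i)) k
    have hd := fun (σ : Equiv.Perm (Fin p)) k => symList_drop_ofFn (fun i => x (σ i)) k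
    simp only [headDeg_eq, tailDeg_eq, ht, hd, smul_comm _ (koszulSign _ _)]
    rw [h, insertion_eq hα, insertion_eq hβ, lieBr_apply, preLie_apply, preLie_apply,
      negOnePow_smul (K := K)]
    simp only [LinearMap.add_apply, LinearMap.sub_apply, LinearMap.neg_apply, LinearMap.smul_apply]
    module
  constructor
  · intro h
    refine symAlg_ext_ofFn fun p x => ?_
    have h1 := h p (fun i => (x i).1) (fun i => ((x i).2 : V)) (fun i => (x i).2.2)
    rw [sub_add_cancel, sub_add_cancel] at h1
    rw [key, word_ofFn, h1]
  · rintro rfl p d v hv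
    have h1 := key p (fun i => (⟨d i, v i, hv i⟩ : Σ i, 𝒱 i))
    rw [sub_add_cancel, sub_add_cancel]
    rwa [word_ofFn] at h1

omit [DirectSum.Decomposition 𝒱] in
theorem hasDegree_sCochain {i : ℤ} (α : sCochain 𝒱 br i) : HasDegree (derDeg 𝒱 br) i α.1 := by
  have := mem_cochain_iff.1 α.2
  rwa [sub_add_cancel] at this

omit [DirectSum.Decomposition 𝒱] in
theorem mem_sCochain {i : ℤ} {α : SymAlg 𝒱 →ₗ[K] Module.End K V}
    (h : HasDegree (derDeg 𝒱 br) i α) : α ∈ cochain 𝒱 br (i - 1) := by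
  rw [mem_cochain_iff, sub_add_cancel]
  exact h

/-- Components whose degrees are only propositionally equal are identified by substitution. The
equation is then checked in an ambient space `E`, here the linear maps without degree condition. -/
theorem lof_eq_sgn_smul {E : Type*} [AddCommGroup E] [Module K E] {M : ℤ → Type*}
    [∀ i, AddCommGroup (M i)] [∀ i, Module K (M i)] (φ : ∀ i, M i →ₗ[K] E)
    (hφ : ∀ i, Function.Injective (φ i)) {i j : ℤ} (h : j = i) (u : ℤ) {x : M i} {y : M j}
    (hxy : φ i x = -(sgn K u • φ j y)) :
    DirectSum.lof K ℤ M i x = -(u.negOnePow • DirectSum.lof K ℤ M j y) := by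
  subst h
  have e : x = -(sgn K u • y) := hφ _ (by rw [hxy, map_neg, map_smul])
  rw [e, map_neg, map_smul, negOnePow_smul (K := K)]

theorem lof_eq_add_sgn_smul {E : Type*} [AddCommGroup E] [Module K E] {M : ℤ → Type*}
    [∀ i, AddCommGroup (M i)] [∀ i, Module K (M i)] (φ : ∀ i, M i →ₗ[K] E)
    (hφ : ∀ i, Function.Injective (φ i)) {i j k : ℤ} (hj : j = i) (hk : k = i) (u : ℤ) {x : M i}
    {y : M j} {z : M k} (h : φ i x = φ j y + sgn K u • φ k z) :
    DirectSum.lof K ℤ M i x = DirectSum.lof K ℤ M j y +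
      u.negOnePow • DirectSum.lof K ℤ M k z := by
  subst hj
  subst hk
  have e : x = y + sgn K u • z := hφ _ (by rw [h, map_add, map_smul])
  rw [e, map_add, map_smul, negOnePow_smul (K := K)]

/-- The bracket of cochains as a bilinear map. -/
noncomputable def sCochainBracket (𝒱 : ℤ → Submodule K V) [DirectSum.Decomposition 𝒱]
    (br : V →ₗ[K] V →ₗ[K] V) (i j : ℤ) :
    sCochain 𝒱 br i →ₗ[K] sCochain 𝒱 br j →ₗ[K] sCochain 𝒱 br (i + j) :=
  LinearMap.mk₂ K (fun α β => ⟨lieBr 𝒱 i j α.1 β.1,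
      mem_sCochain ((hasDegree_sCochain α).lieBr (hasDegree_sCochain β))⟩)
    (fun _ _ _ => Subtype.ext (LinearMap.map_add₂ _ _ _ _))
    (fun _ _ _ => Subtype.ext (LinearMap.map_smul₂ _ _ _ _))
    (fun _ _ _ => Subtype.ext (map_add _ _ _)) (fun _ _ _ => Subtype.ext (map_smul _ _ _))

/-- The differential of cochains as a linear map. -/
noncomputable def sCochainDiff (hbr : IsSymGradedLie 𝒱 br) (i : ℤ) :
    sCochain 𝒱 br i →ₗ[K] sCochain 𝒱 br (i + 1) where
  toFun α := ⟨cochainDiff 𝒱 br i α.1, mem_sCochain ((hasDegree_sCochain α).cochainDiff hbr)⟩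
  map_add' _ _ := Subtype.ext (map_add _ _ _)
  map_smul' _ _ := Subtype.ext (map_smul _ _ _)

theorem coe_sCochainDiff (hbr : IsSymGradedLie 𝒱 br) (i : ℤ) (α : sCochain 𝒱 br i) :
    (sCochainDiff (𝒱 := 𝒱) hbr i α).1 = cochainDiff 𝒱 br i α.1 := rfl

/-- The differential graded Lie algebra of cochains. -/
noncomputable def cochainDGLie [CharZero K] (hbr : IsSymGradedLie 𝒱 br) :
    DGLieAlgebra K (sCochain 𝒱 br) where
  bracket := sCochainBracket 𝒱 br
  diff := sCochainDiff hbr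
  skew i j x y := lof_eq_sgn_smul (fun i => (cochain 𝒱 br (i - 1)).subtype)
    (fun i => Subtype.val_injective) (add_comm j i) _
    (lieBr_skew _ _ _ _)
  jacobi i j k x y z := lof_eq_add_sgn_smul (fun i => (cochain 𝒱 br (i - 1)).subtype)
    (fun i => Subtype.val_injective) (by ring) (by ring) _
    (lieBr_jacobi (hasDegree_sCochain x) (hasDegree_sCochain y) (hasDegree_sCochain z))
  diff_diff i x := Subtype.ext (by
    rw [coe_sCochainDiff, coe_sCochainDiff, cochainDiff_cochainDiff hbr]; rfl)
  diff_bracket i j x y := lof_eq_add_sgn_smul (fun i => (cochain 𝒱 br (i - 1)).subtype)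
    (fun i => Subtype.val_injective) (by ring) (by ring) _
    (cochainDiff_lieBr hbr (hasDegree_sCochain x) (hasDegree_sCochain y))

theorem existsUnique_cochainDGLie [CharZero K] (hbr : IsSymGradedLie 𝒱 br) :
    ∃! D : DGLieAlgebra K (sCochain 𝒱 br),
      (∀ (i : ℤ) (β : sCochain 𝒱 br i),
        IsCochainDiff 𝒱 br (i - 1) β.1 (D.diff i β).1) ∧
      (∀ (i j : ℤ) (α : sCochain 𝒱 br i) (β : sCochain 𝒱 br j),
        IsCochainBracket 𝒱 (i - 1) (j - 1) α.1 β.1 (D.bracket i j α β).1) := by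
  refine ⟨cochainDGLie hbr, ⟨fun i β => (isCochainDiff_iff hbr).2 rfl, fun i j α β =>
    (isCochainBracket_iff (hasDegree_sCochain α) (hasDegree_sCochain β)).2 rfl⟩, ?_⟩
  rintro D ⟨h1, h2⟩
  have e1 : D.diff = sCochainDiff hbr := by
    funext i
    exact LinearMap.ext fun β => Subtype.ext ((isCochainDiff_iff hbr).1 (h1 i β))
  have e2 : D.bracket = sCochainBracket 𝒱 br := by
    funext i j
    exact LinearMap.ext₂ fun α β => Subtype.ext
      ((isCochainBracket_iff (hasDegree_sCochain α) (hasDegree_sCochain β)).1 (h2 i j α β))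
  -- The remaining fields are propositions, so bracket and differential determine the structure.
  cases D
  simp only at e1 e2
  subst e1 e2
  rfl

/-! ### Maurer-Cartan elements -/

/-- In degree 1 the two terms of `lieBr` coincide with sign −1, so half of the bracket is −L ◁ L. -/
theorem isMaurerCartan_iff [CharZero K] (hbr : IsSymGradedLie 𝒱 br)
    {D : DGLieAlgebra K (sCochain 𝒱 br)}
    (h1 : ∀ (i : ℤ) (β : sCochain 𝒱 br i), IsCochainDiff 𝒱 br (i - 1) β.1 (D.diff i β).1)
    (h2 : ∀ (i j : ℤ) (α : sCochain 𝒱 br i) (β : sCochain 𝒱 br j),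
      IsCochainBracket 𝒱 (i - 1) (j - 1) α.1 β.1 (D.bracket i j α β).1)
    (L : sCochain 𝒱 br 1) :
    D.IsMaurerCartan L ↔ preLie 𝒱 1 L.1 L.1 = cochainDiff 𝒱 br 1 L.1 := by
  have e1 := (isCochainDiff_iff hbr).1 (h1 1 L)
  have e2 := (isCochainBracket_iff (hasDegree_sCochain L) (hasDegree_sCochain L)).1 (h2 1 1 L L)
  have e3 : (1 / 2 : K) • lieBr 𝒱 1 1 L.1 L.1 = -preLie 𝒱 1 L.1 L.1 := by
    rw [lieBr_apply, mul_one, sgn_one]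
    module
  have e4 : (D.diff 1 L + (1 / 2 : K) • D.bracket 1 1 L L).1 =
      cochainDiff 𝒱 br 1 L.1 - preLie 𝒱 1 L.1 L.1 := by
    have : (D.diff 1 L + (1 / 2 : K) • D.bracket 1 1 L L).1 =
        (D.diff 1 L).1 + (1 / 2 : K) • (D.bracket 1 1 L L).1 := rfl
    exact this.trans (by rw [e1, e2, e3]; exact (sub_eq_add_neg _ _).symm)
  exact Subtype.ext_iff.trans ((Eq.congr e4 rfl).trans (sub_eq_zero.trans eq_comm))

end Assembly

/-! ### The correspondence between cochains and operations -/

section Operations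

variable {K V : Type*} [Field K] [AddCommGroup V] [Module K V] {𝒱 : ℤ → Submodule K V}
  {br : V →ₗ[K] V →ₗ[K] V}

theorem opOfCochain_snoc (L : SymAlg 𝒱 →ₗ[K] Module.End K V) {p : ℕ} (v : Fin p → V) (x : V) :
    opOfCochain 𝒱 L p (Fin.snoc (α := fun _ => V) v x) = L (symProd 𝒱 p v) x := by
  rw [opOfCochain, MultilinearMap.uncurryRight_apply, Fin.init_snoc, Fin.snoc_last]
  rfl

theorem opEval_opOfCochain (L : SymAlg 𝒱 →ₗ[K] Module.End K V) (l : List V) (x : V) :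
    opEval (opOfCochain 𝒱 L) l x = L (symList 𝒱 l) x :=
  opOfCochain_snoc L l.get x

theorem opOfCochain_injective : Function.Injective
    (opOfCochain 𝒱 : (SymAlg 𝒱 →ₗ[K] Module.End K V) → _) := by
  intro L M h
  refine DirectSum.linearMap_ext K fun k => ?_
  refine Submodule.linearMap_qext _ (PiTensorProduct.ext (MultilinearMap.ext fun v => ?_))
  refine LinearMap.ext fun x => ?_
  have h1 := opOfCochain_snoc L v x
  rw [h, opOfCochain_snoc] at h1
  exact h1.symm

variable [DirectSum.Decomposition 𝒱]

theorem end_ext_homogeneous {f g : Module.End K V} (h : ∀ (e : ℤ), ∀ x ∈ 𝒱 e, f x = g x) :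
    f = g := by
  refine LinearMap.ext fun x => ?_
  induction x using DirectSum.Decomposition.inductionOn 𝒱 with
  | zero => rw [map_zero, map_zero]
  | homogeneous x => exact h _ _ x.2
  | add x y hx hy => rw [map_add, map_add, hx, hy]

/-- Applied to `y`, the first shuffle sum is the Lie derivative part of L ◁ L, the second is its
product part, and the right-hand side is ∂L. -/
theorem opOfCochain_relation_iff [CharZero K] (hbr : IsSymGradedLie 𝒱 br)
    {L : SymAlg 𝒱 →ₗ[K] Module.End K V} (hL : HasDegree (derDeg 𝒱 br) 1 L) {p : ℕ}
    (x : Fin p → Σ i, 𝒱 i) (y : V) :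
    (∑ a : Fin p, ∑ σ ∈ shuffles p [(a : ℕ), 1, p - a - 1],
        koszulSign (fun i => (x i).1) σ •
          opEval (opOfCochain 𝒱 L) (opEval (opOfCochain 𝒱 L)
            ((List.ofFn (fun i => ((x (σ i)).2 : V))).take a) ((x (σ a)).2 : V) ::
              (List.ofFn (fun i => ((x (σ i)).2 : V))).drop (a + 1)) y)
      + (∑ a ∈ Finset.range (p + 1), ∑ σ ∈ shuffles p [a, p - a],
        (headDeg (fun i => (x i).1) σ a).negOnePow • koszulSign (fun i => (x i).1) σ •
          opEval (opOfCochain 𝒱 L) ((List.ofFn (fun i => ((x (σ i)).2 : V))).take a)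
            (opEval (opOfCochain 𝒱 L) ((List.ofFn (fun i => ((x (σ i)).2 : V))).drop a) y))
      = ∑ i : Fin p, ∑ j ∈ Finset.Ioi i,
        ((x i).1 * (∑ a ∈ Finset.Iio i, (x a).1) + (x j).1 * (∑ a ∈ Finset.Iio j, (x a).1)
          + (x i).1 * (x j).1 + 1).negOnePow •
        opEval (opOfCochain 𝒱 L) (br (x i).2 (x j).2 ::
          ((List.ofFn fun c => ((x c).2 : V)).eraseIdx j).eraseIdx i) y ↔
    preLie 𝒱 1 L L (word 𝒱 (List.ofFn x)) y =
      cochainDiff 𝒱 br 1 L (word 𝒱 (List.ofFn x)) y := by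
  have h1 := congrArg (fun f : Module.End K V => f y) (insertion_eq (α := L) hL x)
  have h2 := congrArg (fun f : Module.End K V => f y)
    (prodMap_word (LinearMap.mul K (Module.End K V)) 1 L L (List.ofFn x))
  have h3 := congrArg (fun f : Module.End K V => f y) (cochainDiff_ofFn hbr 1 L x)
  rw [← sum_shuffles_pair] at h2
  have ht := fun (σ : Equiv.Perm (Fin p)) k => symList_take_ofFn (fun i => x (σ i)) k
  have hd := fun (σ : Equiv.Perm (Fin p)) k => symList_drop_ofFn (fun i => x (σ i)) k
  simp only [insertion, LinearMap.sum_apply, LinearMap.smul_apply, LinearMap.mul_apply',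
    Module.End.mul_apply, one_mul] at h1 h2 h3
  rw [preLie_apply, LinearMap.add_apply, LinearMap.add_apply, h2, h3, ← h1]
  simp only [opEval_opOfCochain, headDeg_eq, ht, hd, smul_comm _ (koszulSign _ _)]
  simp only [add_comm (1 : ℤ), add_right_comm _ (1 : ℤ)]

/-- Symmetry holds by the relations in the symmetric power, degree and derivation rule by the values
of L; only the homotopy relation imposes a condition. -/
theorem isOpHomotopyPostLie_opOfCochain_iff [CharZero K] (hbr : IsSymGradedLie 𝒱 br)
    {L : SymAlg 𝒱 →ₗ[K] Module.End K V} (hL : HasDegree (derDeg 𝒱 br) 1 L) :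
    IsOpHomotopyPostLie 𝒱 br (opOfCochain 𝒱 L) ↔
      preLie 𝒱 1 L L = cochainDiff 𝒱 br 1 L := by
  have hmem : ∀ {p : ℕ} {d : Fin p → ℤ} {v : Fin p → V}, (∀ i, v i ∈ 𝒱 (d i)) →
      L (symProd 𝒱 p v) ∈ derDeg 𝒱 br (∑ i, d i + 1) := by
    intro p d v hv
    have := hL (List.ofFn fun i => (⟨d i, v i, hv i⟩ : Σ i, 𝒱 i))
    rwa [word_ofFn, wordDeg_ofFn] at this
  constructor
  · intro h
    refine symAlg_ext_ofFn fun p x => end_ext_homogeneous (𝒱 := 𝒱) fun e y hy => ?_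
    have := h.relation p (fun i => (x i).1) (fun i => ((x i).2 : V)) e y (fun i => (x i).2.2) hy
    exact (opOfCochain_relation_iff hbr hL x y).1 this
  · intro h
    refine ⟨fun k d v hv => ?_, fun p d v e x hv _ σ => ?_, fun p d v e e' x y hv hx hy => ?_,
      fun p d v e x hv _ => ?_⟩
    · rw [← Fin.snoc_init_self v, opOfCochain_snoc, Fin.sum_univ_castSucc, add_comm (Finset.sum _ _),
        add_assoc]
      exact (hmem (d := fun i => d i.castSucc) fun i => hv i.castSucc).1 _ _ (hv (Fin.last k))
    · rw [opOfCochain_snoc, opOfCochain_snoc, symProd_perm 𝒱 d v hv σ,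
        Units.smul_def (koszulSign d σ), Units.smul_def (koszulSign d σ), map_zsmul,
        LinearMap.smul_apply, smul_smul, ← Units.val_mul, Int.units_mul_self, Units.val_one,
        one_smul]
    · rw [opOfCochain_snoc, opOfCochain_snoc, opOfCochain_snoc]
      exact (hmem hv).2 e e' x y hx hy
    · have := opOfCochain_relation_iff hbr hL (fun i => (⟨d i, v i, hv i⟩ : Σ i, 𝒱 i)) x
      exact this.2 (by rw [h])

/-- Curry off the last argument: symmetry lets the result descend to the symmetric powers, while
degree and derivation rule place its values in `derDeg`. -/
theorem exists_opOfCochain_eq {θ : ∀ k : ℕ, MultilinearMap K (fun _ : Fin (k + 1) => V) V}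
    (h : IsOpHomotopyPostLie 𝒱 br θ) :
    ∃ L : SymAlg 𝒱 →ₗ[K] Module.End K V, HasDegree (derDeg 𝒱 br) 1 L ∧ opOfCochain 𝒱 L = θ := by
  have hcurry : ∀ (k : ℕ) (v : Fin k → V) (x : V),
      (θ k).curryRight v x = θ k (Fin.snoc (α := fun _ => V) v x) := fun _ _ _ => rfl
  have hle : ∀ k, symRel 𝒱 k ≤ LinearMap.ker (PiTensorProduct.lift (θ k).curryRight) := by
    intro k
    rw [symRel, Submodule.span_le]
    rintro _ ⟨d, v, σ, hv, rfl⟩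
    rw [SetLike.mem_coe, LinearMap.mem_ker, map_sub, sub_eq_zero]
    refine end_ext_homogeneous (𝒱 := 𝒱) fun e x hx => ?_
    rw [Units.smul_def, map_zsmul, LinearMap.smul_apply, PiTensorProduct.lift.tprod,
      PiTensorProduct.lift.tprod, hcurry, hcurry, h.symm k d v e x hv hx σ, Units.smul_def,
      smul_smul, ← Units.val_mul, Int.units_mul_self, Units.val_one, one_smul]
  let L : SymAlg 𝒱 →ₗ[K] Module.End K V := DirectSum.toModule K ℕ _ fun k =>
    (symRel 𝒱 k).liftQ (PiTensorProduct.lift (θ k).curryRight) (hle k)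
  have hL : ∀ (k : ℕ) (v : Fin k → V) (x : V),
      L (symProd 𝒱 k v) x = θ k (Fin.snoc (α := fun _ => V) v x) := by
    intro k v x
    rw [← hcurry]
    rw [symProd, LinearMap.compMultilinearMap_apply, LinearMap.comp_apply,
      DirectSum.toModule_lof, Submodule.mkQ_apply, Submodule.liftQ_apply, PiTensorProduct.lift.tprod]
  refine ⟨L, fun l => ?_, funext fun k => MultilinearMap.ext fun v => ?_⟩
  · obtain ⟨p, x, rfl⟩ : ∃ (p : ℕ) (x : Fin p → Σ i, 𝒱 i), l = List.ofFn x :=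
      ⟨_, l.get, (List.ofFn_get l).symm⟩
    have hx : ∀ i, ((x i).2 : V) ∈ 𝒱 (x i).1 := fun i => (x i).2.2
    rw [word_ofFn, wordDeg_ofFn]
    refine ⟨fun e y hy => ?_, fun e e' y z hy hz => ?_⟩
    · rw [hL]
      have := h.degree p (Fin.snoc (α := fun _ => ℤ) (fun i => (x i).1) e)
        (Fin.snoc (α := fun _ => V) (fun i => ((x i).2 : V)) y) (Fin.lastCases (by simpa) (by simp))
      rw [Fin.sum_univ_castSucc] at this
      simp only [Fin.snoc_castSucc, Fin.snoc_last] at this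
      rwa [add_comm (Finset.sum _ _), add_assoc] at this
    · rw [hL, hL, hL]
      exact h.derivation p _ _ e e' y z hx hy hz
  · rw [← Fin.snoc_init_self v, opOfCochain_snoc, hL]

end Operations

end OpPostLie

theorem mainTheorem3 {K V : Type*} [Field K] [CharZero K] [AddCommGroup V] [Module K V]
    (𝒱 : ℤ → Submodule K V) [DirectSum.Decomposition 𝒱]
    (br : V →ₗ[K] V →ₗ[K] V) (hbr : IsSymGradedLie 𝒱 br) :
    (∃! D : DGLieAlgebra K (sCochain 𝒱 br),
      (∀ (i : ℤ) (β : sCochain 𝒱 br i),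
        IsCochainDiff 𝒱 br (i - 1) β.1 (D.diff i β).1) ∧
      (∀ (i j : ℤ) (α : sCochain 𝒱 br i) (β : sCochain 𝒱 br j),
        IsCochainBracket 𝒱 (i - 1) (j - 1) α.1 β.1 (D.bracket i j α β).1)) ∧
    ∀ D : DGLieAlgebra K (sCochain 𝒱 br),
      (∀ (i : ℤ) (β : sCochain 𝒱 br i),
        IsCochainDiff 𝒱 br (i - 1) β.1 (D.diff i β).1) →
      (∀ (i j : ℤ) (α : sCochain 𝒱 br i) (β : sCochain 𝒱 br j),
        IsCochainBracket 𝒱 (i - 1) (j - 1) α.1 β.1 (D.bracket i j α β).1) →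
      (∀ L : sCochain 𝒱 br 1,
        D.IsMaurerCartan L ↔ IsOpHomotopyPostLie 𝒱 br (opOfCochain 𝒱 L.1)) ∧
      (∀ θ : ∀ k : ℕ, MultilinearMap K (fun _ : Fin (k + 1) => V) V,
        IsOpHomotopyPostLie 𝒱 br θ →
          ∃! L : sCochain 𝒱 br 1, opOfCochain 𝒱 L.1 = θ) := by
  refine ⟨existsUnique_cochainDGLie hbr, fun D h1 h2 => ⟨fun L => ?_, fun θ hθ => ?_⟩⟩
  · exact (isMaurerCartan_iff hbr h1 h2 L).trans
      (isOpHomotopyPostLie_opOfCochain_iff hbr (hasDegree_sCochain L)).symm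
  · obtain ⟨L, hL, rfl⟩ := exists_opOfCochain_eq hθ
    exact ⟨⟨L, mem_sCochain hL⟩, rfl, fun M hM => Subtype.ext (opOfCochain_injective hM)⟩
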